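/- Let $\mathbb{K}\in\{\mathbb{R},\mathbb{C}\}$, $a<b$ and $n\in\mathbb{N}$. Consider the hyperbolic boundary control system (hBCS) $$\frac{\partial x}{\partial t}(\xi,t)=P_1\frac{\partial}{\partial\xi}\bigl(\mathcal{H}(\xi)x(\xi,t)\bigr)+P_0(\xi)\mathcal{H}(\xi)x(\xi,t),\qquad u(t)=\widetilde W_B\begin{bmatrix}(\mathcal{H}x)(b,t)\\(\mathcal{H}x)(a,t)\end{bmatrix},\qquad y(t)=\widetilde W_C\begin{bmatrix}(\mathcal{H}x)(b,t)\\(\mathcal{H}x)(a,t)\end{bmatrix}$$ for $\xi\in[a,b]$, $t\ge 0$, and assume the following. 1. $P_1\in\mathbb{K}^{n\times n}$ is invertible and self-adjoint; $P_0\in L^\infty([a,b],\mathbb{K}^{n\times n})$; $\mathcal{H}\in L^\infty([a,b],\mathbb{K}^{n\times n})$, $\mathcal{H}(\xi)$ is self-adjoint for almost all $\xi$, and there are $M,m>0$ with $mI\le\mathcal{H}(\xi)\le MI$ for almost all $\xi\in[a,b]$; $\widetilde W_B,\widetilde W_C\in\mathbb{K}^{n\times 2n}$, and both $\widetilde W_B$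 and $\begin{bmatrix}\widetilde W_B\\ \widetilde W_C\end{bmatrix}\in\mathbb{K}^{2n\times 2n}$ have full rank; the operator $A=P_1\frac{\partial}{\partial\xi}\mathcal{H}+P_0\mathcal{H}$ with domain $$\mathrm{D}(A)=\Bigl\{x_0\in L^2([a,b],\mathbb{K}^n)\;\Big|\;\mathcal{H}x_0\in H^1([a,b],\mathbb{K}^n),\ \widetilde W_B\begin{bmatrix}(\mathcal{H}x_0)(b)\\(\mathcal{H}x_0)(a)\end{bmatrix}=0\Bigr\}$$ generates a $C_0$-semigroup on $L^2([a,b],\mathbb{K}^n)$. 2. There are $S,\mathcal{H}^D\in C^1([a,b],\mathbb{K}^{n\times n})$, with $S$ pointwise invertible and $\mathcal{H}^D$ pointwise diagonal and positive definite, and some $0\le k\le n$ such that $P_1\mathcal{H}=S^{-1}\begin{pmatrix}I_k&0\\0&-I_{n-k}\end{pmatrix}\mathcal{H}^D S$ almost everywhere on $[a,b]$. A classical solution on the state space $L^1([a,b],\mathbb{K}^n)$ is a triple $(u,x,y)$ with $u,y\in C([0,\infty),\mathbb{K}^n)$ and $x\in C^1([0,\infty),L^1([a,b],\mathbb{K}^n))$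 such that, for every $t\ge 0$, $\mathcal{H}x(t)\in W^{1,1}([a,b],\mathbb{K}^n)$ and the three equations above hold (the first one in $L^1$). Then the system is $L^1$-well-posed on the state space $L^1([a,b],\mathbb{K}^n)$, that is: for every $t>0$ there is a constant $c>0$ such that every classical solution $(u,x,y)$ on $L^1([a,b],\mathbb{K}^n)$ satisfies $$\|y\|_{L^1([0,t],\mathbb{K}^n)}+\|x(t)\|_{L^1([a,b],\mathbb{K}^n)}\le c\bigl(\|u\|_{L^1([0,t],\mathbb{K}^n)}+\|x(0)\|_{L^1([a,b],\mathbb{K}^n)}\bigr).$$ -/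

import Mathlib

open MeasureTheory Filter Topology Set
open scoped ComplexOrder

noncomputable section

/-- A strongly continuous one-parameter semigroup `(T t)_{t ≥ 0}` of bounded operators
(only the values at `t ≥ 0` matter). -/
structure IsC0Semigroup {𝕜 X : Type*} [RCLike 𝕜] [NormedAddCommGroup X] [NormedSpace 𝕜 X]
    (T : ℝ → X →L[𝕜] X) : Prop where
  map_zero : T 0 = ContinuousLinearMap.id 𝕜 X
  map_add : ∀ s t : ℝ, 0 ≤ s → 0 ≤ t → T (s + t) = (T s).comp (T t)
  strongly_continuous : ∀ x : X, Tendsto (fun t : ℝ => T t x) (𝓝[>] 0) (𝓝 x)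

/-- The (possibly unbounded) operator with graph `{(x, z) | A x z}` is the infinitesimal generator
of some strongly continuous semigroup on `X`: the pair `(x, z)` lies in the graph
(i.e. `x ∈ D(A)` and `A x = z`) if and only if `(T h x - x) / h → z` as `h → 0+`. -/
def GeneratesC0Semigroup (𝕜 : Type*) {X : Type*} [RCLike 𝕜] [NormedAddCommGroup X]
    [NormedSpace 𝕜 X] (A : X → X → Prop) : Prop :=
  ∃ T : ℝ → X →L[𝕜] X, IsC0Semigroup T ∧
    ∀ x z : X, A x z ↔
      Tendsto (fun h : ℝ => ((h : 𝕜)⁻¹) • (T h x - x)) (𝓝[>] 0) (𝓝 z)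

/-- `𝕂ⁿ` with its Euclidean norm. -/
abbrev KVec (𝕜 : Type*) [RCLike 𝕜] (n : ℕ) : Type _ := EuclideanSpace 𝕜 (Fin n)

/-- Matrix-vector product on `𝕂ⁿ` with its Euclidean norm. -/
def matAct {𝕜 : Type*} [RCLike 𝕜] {n : ℕ} (M : Matrix (Fin n) (Fin n) 𝕜) (w : KVec 𝕜 n) :
    KVec 𝕜 n :=
  WithLp.toLp 2 (M.mulVec w.ofLp)

/-- The product `W [w₁; w₂]` of an `n × 2n` matrix with a stacked vector. -/
def bdryAct {𝕜 : Type*} [RCLike 𝕜] {n : ℕ} (W : Matrix (Fin n) (Fin n ⊕ Fin n) 𝕜)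
    (w₁ w₂ : KVec 𝕜 n) : KVec 𝕜 n :=
  WithLp.toLp 2 (W.mulVec (Sum.elim w₁.ofLp w₂.ofLp))

/-- `v` is an absolutely continuous function on `[a,b]` whose derivative is (almost everywhere)
`g ∈ L^p([a,b])`; that is, `v` is the continuous representative of an element of `W^{1,p}` on
`[a,b]` and `g` is its weak derivative (`W^{1,2} = H¹`). -/
def HasSobolevDeriv {E : Type*} [NormedAddCommGroup E] [NormedSpace ℝ E] (p : ENNReal) (a b : ℝ)
    (v g : ℝ → E) : Prop :=
  MemLp g p (volume.restrict (Icc a b)) ∧ ∀ ξ ∈ Icc a b, v ξ = v a + ∫ s in a..ξ, g s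

/-- The data of a linear hyperbolic boundary control system on `[a,b]` with `n` components. -/
structure HBCS (𝕜 : Type*) [RCLike 𝕜] (n : ℕ) where
  a : ℝ
  b : ℝ
  hab : a < b
  /-- the matrix in front of the spatial derivative -/
  P₁ : Matrix (Fin n) (Fin n) 𝕜
  /-- the zero order coefficient -/
  P₀ : ℝ → Matrix (Fin n) (Fin n) 𝕜
  /-- the Hamiltonian -/
  H : ℝ → Matrix (Fin n) (Fin n) 𝕜
  /-- the boundary input matrix -/
  WB : Matrix (Fin n) (Fin n ⊕ Fin n) 𝕜
  /-- the boundary output matrix -/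
  WC : Matrix (Fin n) (Fin n ⊕ Fin n) 𝕜

namespace HBCS

variable {𝕜 : Type*} [RCLike 𝕜] {n : ℕ}

/-- Lebesgue measure on `[a,b]`. -/
def measure (Sys : HBCS 𝕜 n) : Measure ℝ := volume.restrict (Icc Sys.a Sys.b)

/-- The space `L^p([a,b], 𝕂ⁿ)`. -/
abbrev StateSpace (Sys : HBCS 𝕜 n) (p : ENNReal) : Type _ := Lp (KVec 𝕜 n) p Sys.measure

/-- `H x ∈ W^{1,p}([a,b], 𝕂ⁿ)` with continuous representative `v`, and
`z = P₁ ∂/∂ξ (H x) + P₀ (H x)`. -/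
def MaxOperator (Sys : HBCS 𝕜 n) (p : ENNReal) (x z : Sys.StateSpace p) (v : ℝ → KVec 𝕜 n) :
    Prop :=
  ∃ g : ℝ → KVec 𝕜 n, HasSobolevDeriv p Sys.a Sys.b v g ∧
    (∀ᵐ ξ ∂Sys.measure, v ξ = matAct (Sys.H ξ) (x ξ)) ∧
    (∀ᵐ ξ ∂Sys.measure, z ξ = matAct Sys.P₁ (g ξ) + matAct (Sys.P₀ ξ) (v ξ))

/-- The graph of the operator `A = P₁ ∂/∂ξ H + P₀ H` on `L^p([a,b], 𝕂ⁿ)` with domain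
`{x | H x ∈ W^{1,p}, W_B [(H x)(b); (H x)(a)] = 0}`. -/
def OperatorA (Sys : HBCS 𝕜 n) (p : ENNReal) (x z : Sys.StateSpace p) : Prop :=
  ∃ v : ℝ → KVec 𝕜 n, Sys.MaxOperator p x z v ∧ bdryAct Sys.WB (v Sys.b) (v Sys.a) = 0

/-- The standing assumptions on the system. The generation property is required on
`L²([a,b], 𝕂ⁿ)`; being the generator of a strongly continuous semigroup does not change
under passage to an equivalent norm, in particular to the norm
`‖f‖² = (1/2) ∫ f* H f`. -/
structure StandingAssumptions (Sys : HBCS 𝕜 n) : Prop where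
  P₁_isUnit : IsUnit Sys.P₁
  P₁_selfAdjoint : Sys.P₁.IsHermitian
  P₀_bounded : ∀ i j, MemLp (fun ξ => Sys.P₀ ξ i j) ⊤ Sys.measure
  H_bounded : ∀ i j, MemLp (fun ξ => Sys.H ξ i j) ⊤ Sys.measure
  H_selfAdjoint : ∀ᵐ ξ ∂Sys.measure, (Sys.H ξ).IsHermitian
  H_coercive : ∃ m M : ℝ, 0 < m ∧ 0 < M ∧ ∀ᵐ ξ ∂Sys.measure,
    (Sys.H ξ - (m : 𝕜) • (1 : Matrix (Fin n) (Fin n) 𝕜)).PosSemidef ∧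
    ((M : 𝕜) • (1 : Matrix (Fin n) (Fin n) 𝕜) - Sys.H ξ).PosSemidef
  WB_fullRank : Sys.WB.rank = n
  WBC_fullRank : (Matrix.fromRows Sys.WB Sys.WC).rank = 2 * n
  generates : GeneratesC0Semigroup 𝕜 (Sys.OperatorA 2)

/-- The `C¹`-diagonalisation assumption: there are `C¹` matrix functions `S`, `H^D` on `[a,b]`,
with `S` pointwise invertible and `H^D` diagonal and positive, such that
`P₁ H = S⁻¹ P₁^D H^D S` with `P₁^D = diag(I_m, -I_{n-m})` for some `0 ≤ m ≤ n`. -/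
def DiagonalisationAssumption (Sys : HBCS 𝕜 n) : Prop :=
  ∃ (S HD : ℝ → Matrix (Fin n) (Fin n) 𝕜) (m : ℕ), m ≤ n ∧
    (∀ i j, ContDiffOn ℝ 1 (fun ξ => S ξ i j) (Icc Sys.a Sys.b)) ∧
    (∀ i j, ContDiffOn ℝ 1 (fun ξ => HD ξ i j) (Icc Sys.a Sys.b)) ∧
    (∀ ξ ∈ Icc Sys.a Sys.b, IsUnit (S ξ)) ∧
    (∀ ξ ∈ Icc Sys.a Sys.b, (HD ξ).IsDiag ∧ (HD ξ).PosDef) ∧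
    ∀ᵐ ξ ∂Sys.measure, Sys.P₁ * Sys.H ξ =
      (S ξ)⁻¹ * Matrix.diagonal (fun i : Fin n => if i.val < m then (1 : 𝕜) else -1) * HD ξ * S ξ

/-- `(u, x, y)` is a classical solution of the system on the state space `L^p([a,b], 𝕂ⁿ)`:
`u, y ∈ C([0,∞), 𝕂ⁿ)`, `x ∈ C¹([0,∞), L^p)`, and for every `t ≥ 0`
`x'(t) = P₁ ∂/∂ξ (H x(t)) + P₀ (H x(t))`, `u(t) = W_B [(H x(t))(b); (H x(t))(a)]` and
`y(t) = W_C [(H x(t))(b); (H x(t))(a)]`. -/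
structure IsClassicalSolution (Sys : HBCS 𝕜 n) (p : ENNReal) [Fact (1 ≤ p)]
    (u : ℝ → KVec 𝕜 n) (x : ℝ → Sys.StateSpace p) (y : ℝ → KVec 𝕜 n) : Prop where
  u_cont : ContinuousOn u (Ici 0)
  y_cont : ContinuousOn y (Ici 0)
  x_contDiff : ContDiffOn ℝ 1 x (Ici 0)
  eqn : ∀ t : ℝ, 0 ≤ t → ∃ v : ℝ → KVec 𝕜 n,
    Sys.MaxOperator p (x t) (derivWithin x (Ici 0) t) v ∧
    u t = bdryAct Sys.WB (v Sys.b) (v Sys.a) ∧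
    y t = bdryAct Sys.WC (v Sys.b) (v Sys.a)

end HBCS

end

/-!
Diagonalising `P₁ H` by `S` turns the system into transport equations with speeds `±H^D`, coupled
only through a bounded zeroth order term and the boundary conditions; each characteristic variable
is carried from an inflow end of `[a, b]` to an outflow end.

Generation on `L²` enters through a single consequence: the input together with the outgoing fluxes
determines both boundary values. Otherwise some nontrivial combination of outgoing fluxes vanishes
on `ker W_B`. Pair the `i`-th characteristic variable with `e^{-l τ}`, where `τ` is the travel time
to its outflow end. By integration by parts the corresponding combination `Φ` of these functionals
satisfies `Φ A = l Φ + o(1) + Φ B` on `D(A)` with `B` bounded, so the resolvent bound for a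
generator makes `l Φ` tend to zero. But the pairings concentrate at the outflow ends and, multiplied
by `l`, have linearly independent limits on suitable test states.

Hence the incoming fluxes are bounded by the input and the outgoing fluxes. Rescaling the
characteristic variables by a weight which is one at the inflow end and large at the outflow end
absorbs this feedback: the derivative of the weighted `L¹` norm of a solution is at most a multiple
of the norm plus a multiple of the input minus the outgoing flux. Grönwall's inequality then bounds
the state and the outgoing flux, and input and outgoing flux together bound the output.
-/

noncomputable section

/-- `f` is absolutely continuous on `[a, b]` and `f'` is its integrable derivative almost
everywhere. Unlike `HasSobolevDeriv`, this asks nothing of the values of `f` outside `(a, b)` and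
is stable under products and norms. -/
structure HasACDeriv {E : Type*} [NormedAddCommGroup E] [NormedSpace ℝ E] (a b : ℝ)
    (f f' : ℝ → E) : Prop where
  ac : AbsolutelyContinuousOnInterval f a b
  intervalIntegrable : IntervalIntegrable f' volume a b
  hasDerivAt : ∀ᵐ x, x ∈ Ioo a b → HasDerivAt f (f' x) x

section AbsoluteContinuity

variable {E F : Type*} [NormedAddCommGroup E] [NormedSpace ℝ E]
  [NormedAddCommGroup F] [NormedSpace ℝ F] {a b : ℝ}

theorem absolutelyContinuousOnInterval_of_dist_le {X Y : Type*} [PseudoMetricSpace X]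
    [PseudoMetricSpace Y] {f : ℝ → X} {g : ℝ → Y} (K : ℝ)
    (hg : AbsolutelyContinuousOnInterval g a b)
    (h : ∀ x ∈ uIcc a b, ∀ y ∈ uIcc a b, dist (f x) (f y) ≤ K * dist (g x) (g y)) :
    AbsolutelyContinuousOnInterval f a b := by
  unfold AbsolutelyContinuousOnInterval at hg ⊢
  refine squeeze_zero' (.of_forall fun _ ↦ Finset.sum_nonneg fun _ _ ↦ dist_nonneg) ?_
    (by simpa using hg.const_mul K)
  rw [eventually_inf_principal]
  filter_upwards with (m, I) hI
  simp only [AbsolutelyContinuousOnInterval.disjWithin, mem_ofPred_eq] at hI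
  rw [Finset.mul_sum]
  exact Finset.sum_le_sum fun i hi ↦ h _ (hI.left i hi).1 _ (hI.left i hi).2

theorem absolutelyContinuousOnInterval_primitive {g : ℝ → E}
    (hg : IntervalIntegrable g volume a b) :
    AbsolutelyContinuousOnInterval (fun x ↦ ∫ s in a..x, g s) a b := by
  refine absolutelyContinuousOnInterval_of_dist_le 1
    (hg.norm.absolutelyContinuousOnInterval_intervalIntegral (c := a) left_mem_uIcc) ?_
  intro x hx y hy
  have hint : ∀ z ∈ uIcc a b, IntervalIntegrable g volume a z := fun z hz ↦
    hg.mono_set (uIcc_subset_uIcc_left hz)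
  rw [one_mul, dist_eq_norm, Real.dist_eq,
    intervalIntegral.integral_interval_sub_left (hint x hx) (hint y hy),
    intervalIntegral.integral_interval_sub_left (hint x hx).norm (hint y hy).norm]
  exact intervalIntegral.norm_integral_le_abs_integral_norm

theorem ae_uIoc_of_ae_Ioo (hab : a ≤ b) {P : ℝ → Prop} (h : ∀ᵐ x, x ∈ Ioo a b → P x) :
    ∀ᵐ x ∂volume.restrict (uIoc a b), P x := by
  rw [uIoc_of_le hab, ← restrict_Ioo_eq_restrict_Ioc]
  exact (ae_restrict_iff' measurableSet_Ioo).2 h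

namespace HasACDeriv

variable {f f' g g' : ℝ → E}

theorem integral_eq_sub [CompleteSpace E] (hab : a ≤ b) (h : HasACDeriv a b f f') :
    ∫ s in a..b, f' s = f b - f a := by
  have hderiv : ∀ᵐ x, x ∈ uIcc a b → HasDerivAt (fun x ↦ f x - ∫ s in a..x, f' s) 0 x := by
    filter_upwards [Measure.ae_ne volume a, Measure.ae_ne volume b, h.hasDerivAt,
      h.intervalIntegrable.ae_hasDerivAt_integral] with x hxa hxb hf hint hx
    have hprim := hint hx a left_mem_uIcc
    rw [uIcc_of_le hab] at hx
    exact ((hf ⟨lt_of_le_of_ne hx.1 hxa.symm, lt_of_le_of_ne hx.2 hxb⟩).sub hprim).congr_deriv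
      (sub_self _)
  obtain ⟨C, hC⟩ := (h.ac.sub (absolutelyContinuousOnInterval_primitive
    h.intervalIntegrable)).const_of_ae_hasDerivAt_zero hderiv
  have ha := hC a left_mem_uIcc
  have hb := hC b right_mem_uIcc
  simp only [Pi.sub_apply, intervalIntegral.integral_same, sub_zero] at ha hb
  rw [ha, ← hb, sub_sub_cancel]

theorem of_hasDerivWithinAt (hab : a ≤ b)
    (hf : ∀ x ∈ Icc a b, HasDerivWithinAt f (f' x) (Icc a b) x)
    (hf' : ContinuousOn f' (Icc a b)) : HasACDeriv a b f f' := by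
  obtain ⟨K, hK⟩ := isCompact_Icc.exists_bound_of_continuousOn hf'
  refine ⟨?_, ContinuousOn.intervalIntegrable (by rwa [uIcc_of_le hab]),
    .of_forall fun x hx ↦ (hf x (Ioo_subset_Icc_self hx)).hasDerivAt (Icc_mem_nhds hx.1 hx.2)⟩
  refine LipschitzOnWith.absolutelyContinuousOnInterval (K := K.toNNReal) ?_
  rw [uIcc_of_le hab]
  exact (convex_Icc a b).lipschitzOnWith_of_nnnorm_hasDerivWithin_le hf fun x hx ↦
    (hK x hx).trans (Real.le_coe_toNNReal K)

theorem clm_comp (L : E →L[ℝ] F) (h : HasACDeriv a b f f') :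
    HasACDeriv a b (fun x ↦ L (f x)) (fun x ↦ L (f' x)) := by
  refine ⟨absolutelyContinuousOnInterval_of_dist_le ‖L‖ h.ac fun _ _ _ _ ↦ L.dist_le_opNorm _ _,
    ⟨L.integrable_comp h.intervalIntegrable.1, L.integrable_comp h.intervalIntegrable.2⟩, ?_⟩
  filter_upwards [h.hasDerivAt] with x hx hxI
  exact L.hasFDerivAt.comp_hasDerivAt x (hx hxI)

theorem add (hf : HasACDeriv a b f f') (hg : HasACDeriv a b g g') :
    HasACDeriv a b (fun x ↦ f x + g x) (fun x ↦ f' x + g' x) := by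
  refine ⟨hf.ac.add hg.ac, hf.intervalIntegrable.add hg.intervalIntegrable, ?_⟩
  filter_upwards [hf.hasDerivAt, hg.hasDerivAt] with x hfx hgx hx
  exact (hfx hx).add (hgx hx)

theorem sum {ι : Type*} (s : Finset ι) {f f' : ι → ℝ → E}
    (h : ∀ i ∈ s, HasACDeriv a b (f i) (f' i)) :
    HasACDeriv a b (fun x ↦ ∑ i ∈ s, f i x) (fun x ↦ ∑ i ∈ s, f' i x) := by
  classical
  induction s using Finset.induction_on with
  | empty =>
    exact ⟨(LipschitzWith.const 0).lipschitzOnWith.absolutelyContinuousOnInterval,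
      intervalIntegrable_const, .of_forall fun x _ ↦ hasDerivAt_const x 0⟩
  | insert i s hi ih =>
    simp only [Finset.sum_insert hi]
    exact (h i (Finset.mem_insert_self i s)).add
      (ih fun j hj ↦ h j (Finset.mem_insert_of_mem hj))

theorem mul {A : Type*} [NormedField A] [NormedAlgebra ℝ A] {f f' g g' : ℝ → A}
    (hf : HasACDeriv a b f f') (hg : HasACDeriv a b g g') :
    HasACDeriv a b (fun x ↦ f x * g x) (fun x ↦ f' x * g x + f x * g' x) := by
  refine ⟨hf.ac.smul hg.ac, (hf.intervalIntegrable.mul_continuousOn hg.ac.continuousOn).add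
    (hg.intervalIntegrable.continuousOn_mul hf.ac.continuousOn), ?_⟩
  filter_upwards [hf.hasDerivAt, hg.hasDerivAt] with x hfx hgx hx
  exact (hfx hx).mul (hgx hx)

theorem of_deriv_eq (hab : a ≤ b) {f f' : ℝ → ℝ} (hf : AbsolutelyContinuousOnInterval f a b)
    (hf' : ∀ᵐ x, x ∈ Ioo a b → DifferentiableAt ℝ f x → deriv f x = f' x) :
    HasACDeriv a b f f' := by
  have hderiv : ∀ᵐ x, x ∈ Ioo a b → HasDerivAt f (f' x) x := by
    filter_upwards [hf.ae_differentiableAt, hf'] with x hdiff hx hxI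
    have hdx := hdiff (by rw [uIcc_of_le hab]; exact Ioo_subset_Icc_self hxI)
    exact hx hxI hdx ▸ hdx.hasDerivAt
  refine ⟨hf, hf.intervalIntegrable_deriv.congr_ae (ae_uIoc_of_ae_Ioo hab ?_), hderiv⟩
  filter_upwards [hderiv] with x hx hxI using (hx hxI).deriv

end HasACDeriv

theorem HasSobolevDeriv.hasACDeriv [CompleteSpace E] {p : ENNReal} (hp : 1 ≤ p) (hab : a ≤ b)
    {v g : ℝ → E} (h : HasSobolevDeriv p a b v g) : HasACDeriv a b v g := by
  have hint : IntervalIntegrable g volume a b :=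
    (intervalIntegrable_iff_integrableOn_Icc_of_le hab).2 (h.1.integrable hp)
  refine ⟨absolutelyContinuousOnInterval_of_dist_le 1
    (absolutelyContinuousOnInterval_primitive hint) fun x hx y hy ↦ ?_, hint, ?_⟩
  · rw [uIcc_of_le hab] at hx hy
    simp [h.2 x hx, h.2 y hy]
  · filter_upwards [hint.ae_hasDerivAt_integral] with x hx hxI
    have hxI' := uIcc_of_le hab ▸ Ioo_subset_Icc_self hxI
    refine ((hx hxI' a left_mem_uIcc).const_add (v a)).congr_of_eventuallyEq ?_
    filter_upwards [Ioo_mem_nhds hxI.1 hxI.2] with y hy using h.2 y (Ioo_subset_Icc_self hy)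

theorem eq_of_hasDerivAt_of_touching {f g : ℝ → ℝ} {f' g' x : ℝ} (hf : HasDerivAt f f' x)
    (hg : HasDerivAt g g' x) (hle : ∀ᶠ y in 𝓝 x, g y ≤ f y) (heq : g x = f x) : f' = g' := by
  have hmin : IsLocalMin (f - g) x := by
    filter_upwards [hle] with y hy
    simpa [heq] using hy
  exact sub_eq_zero.1 (hmin.hasDerivAt_eq_zero (hf.sub hg))

end AbsoluteContinuity

section Phase

variable {𝕜 : Type*} [RCLike 𝕜] {a b : ℝ}

/-- The number of modulus at most one that rotates `z` onto `‖z‖`, with the value `0` at `z = 0`;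
`w ↦ re (conjPhase z * w)` is a subgradient of the norm at `z`. -/
def conjPhase (z : 𝕜) : 𝕜 := ((‖z‖⁻¹ : ℝ) : 𝕜) * starRingEnd 𝕜 z

theorem conjPhase_mul_self (z : 𝕜) : conjPhase z * z = (‖z‖ : 𝕜) := by
  rw [conjPhase, mul_assoc, RCLike.conj_mul, ← RCLike.ofReal_pow, ← RCLike.ofReal_mul, sq,
    ← mul_assoc]
  congr 1
  exact inv_mul_mul_self _

theorem norm_conjPhase_le (z : 𝕜) : ‖conjPhase z‖ ≤ 1 := by
  rw [conjPhase, norm_mul, RCLike.norm_conj, RCLike.norm_ofReal, abs_inv, abs_norm]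
  exact inv_mul_le_one

theorem re_conjPhase_mul_le (z w : 𝕜) : RCLike.re (conjPhase z * w) ≤ ‖w‖ :=
  (RCLike.re_le_norm _).trans
    ((norm_mul_le _ _).trans (mul_le_of_le_one_left (norm_nonneg _) (norm_conjPhase_le z)))

theorem measurable_conjPhase : Measurable (conjPhase : 𝕜 → 𝕜) :=
  (RCLike.measurable_ofReal.comp measurable_norm.inv).mul RCLike.continuous_conj.measurable

theorem conjPhase_ofReal_mul (r : ℝ) (z : 𝕜) :
    conjPhase ((r : 𝕜) * z) = ((r / |r| : ℝ) : 𝕜) * conjPhase z := by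
  rw [conjPhase, conjPhase, norm_mul, RCLike.norm_ofReal, map_mul, RCLike.conj_ofReal, mul_inv]
  push_cast
  ring

theorem HasACDeriv.norm (hab : a ≤ b) {w w' : ℝ → 𝕜} (h : HasACDeriv a b w w') :
    HasACDeriv a b (fun x ↦ ‖w x‖) (fun x ↦ RCLike.re (conjPhase (w x) * w' x)) := by
  refine .of_deriv_eq hab (absolutelyContinuousOnInterval_of_dist_le 1 h.ac fun x _ y _ ↦ ?_) ?_
  · rw [one_mul, dist_eq_norm (w x)]
    exact dist_norm_norm_le (w x) (w y)
  filter_upwards [h.hasDerivAt] with x hw hxI hdiff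
  have hsub : HasDerivAt (fun y ↦ RCLike.re (conjPhase (w x) * w y))
      (RCLike.re (conjPhase (w x) * w' x)) x :=
    (RCLike.reCLM (K := 𝕜)).hasFDerivAt.comp_hasDerivAt x ((hw hxI).const_mul (conjPhase (w x)))
  exact eq_of_hasDerivAt_of_touching hdiff.hasDerivAt hsub
    (.of_forall fun y ↦ re_conjPhase_mul_le _ _) (by simp [conjPhase_mul_self])

end Phase

theorem hasACDeriv_exp_neg_mul {a b : ℝ} (hab : a ≤ b) (C : ℝ) :
    HasACDeriv a b (fun t ↦ Real.exp (-(C * t))) (fun t ↦ -C * Real.exp (-(C * t))) := by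
  refine .of_hasDerivWithinAt hab (fun t _ ↦ HasDerivAt.hasDerivWithinAt ?_) (by fun_prop)
  refine (((hasDerivAt_id t).const_mul C).neg.exp).congr_deriv ?_
  simp only [id_eq, Pi.neg_apply, mul_one, mul_neg, neg_mul, neg_inj]
  ring

theorem gronwall_of_hasACDeriv {T C : ℝ} (hT : 0 ≤ T) (hC : 0 ≤ C) {V V' q o : ℝ → ℝ}
    (hV : HasACDeriv 0 T V V') (hq : IntervalIntegrable q volume 0 T)
    (ho : IntervalIntegrable o volume 0 T) (hq_nonneg : ∀ t ∈ Ioo 0 T, 0 ≤ q t)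
    (ho_nonneg : ∀ t ∈ Ioo 0 T, 0 ≤ o t)
    (hV' : ∀ᵐ t, t ∈ Ioo 0 T → V' t ≤ q t - o t + C * V t) :
    V T + ∫ t in 0..T, o t ≤ Real.exp (C * T) * (V 0 + ∫ t in 0..T, q t) := by
  have hE := hasACDeriv_exp_neg_mul hT C
  have hle : (∫ t in 0..T, (-C * Real.exp (-(C * t)) * V t + Real.exp (-(C * t)) * V' t)) ≤
      ∫ t in 0..T, (q t - Real.exp (-(C * T)) * o t) := by
    refine intervalIntegral.integral_mono_ae_restrict hT (hE.mul hV).intervalIntegrable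
      (hq.sub (ho.const_mul _)) ?_
    rw [← restrict_Ioo_eq_restrict_Icc]
    refine (ae_restrict_iff' measurableSet_Ioo).2 ?_
    filter_upwards [hV'] with t ht htI
    have hexp_le_one : Real.exp (-(C * t)) ≤ 1 := Real.exp_le_one_iff.2 (by nlinarith [htI.1])
    have hexp_antitone : Real.exp (-(C * T)) ≤ Real.exp (-(C * t)) :=
      Real.exp_le_exp.2 (by nlinarith [htI.2])
    nlinarith [mul_le_mul_of_nonneg_left (ht htI) (Real.exp_pos (-(C * t))).le, hq_nonneg t htI,
      ho_nonneg t htI, mul_le_mul_of_nonneg_right hexp_le_one (hq_nonneg t htI),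
      mul_le_mul_of_nonneg_right hexp_antitone (ho_nonneg t htI)]
  rw [(hE.mul hV).integral_eq_sub hT, intervalIntegral.integral_sub hq (ho.const_mul _),
    intervalIntegral.integral_const_mul, Real.exp_neg] at hle
  have hpos := Real.exp_pos (C * T)
  calc V T + ∫ t in 0..T, o t
      = Real.exp (C * T) * ((Real.exp (C * T))⁻¹ * V T + (Real.exp (C * T))⁻¹ *
          ∫ t in 0..T, o t) := by field_simp
    _ ≤ Real.exp (C * T) * (V 0 + ∫ t in 0..T, q t) := by
      simp only [mul_zero, neg_zero, Real.exp_zero, one_mul] at hle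
      exact mul_le_mul_of_nonneg_left (by linarith) hpos.le

section Semigroup

variable {𝕜 X : Type*} [RCLike 𝕜] [NormedAddCommGroup X] [NormedSpace 𝕜 X]

namespace IsC0Semigroup

variable {T : ℝ → X →L[𝕜] X}

theorem apply_add (hT : IsC0Semigroup T) {s t : ℝ} (hs : 0 ≤ s) (ht : 0 ≤ t) (x : X) :
    T (s + t) x = T s (T t x) := by
  rw [hT.map_add s t hs ht, ContinuousLinearMap.comp_apply]

theorem exists_norm_le [CompleteSpace X] (hT : IsC0Semigroup T) :
    ∃ δ : ℝ, 0 < δ ∧ ∃ C : ℝ, 0 < C ∧ ∀ t ∈ Icc 0 δ, ‖T t‖ ≤ C := by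
  by_contra! hunbdd
  have hlarge (k : ℕ) : ∃ t ∈ Icc (0 : ℝ) (1 / ((k : ℝ) + 1)), (k : ℝ) + 1 < ‖T t‖ :=
    hunbdd _ (by positivity) _ (by positivity)
  choose t ht htk using hlarge
  have htend : Tendsto t atTop (𝓝 0) :=
    squeeze_zero (fun k ↦ (ht k).1) (fun k ↦ (ht k).2) tendsto_one_div_add_atTop_nhds_zero_nat
  have hpointwise (x : X) : ∃ C, ∀ k, ‖T (t k) x‖ ≤ C := by
    have hcont : ContinuousWithinAt (fun s ↦ T s x) (Ici 0) 0 := by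
      rw [← Ioi_insert, continuousWithinAt_insert_self, ContinuousWithinAt, hT.map_zero]
      exact hT.strongly_continuous x
    have hlim : Tendsto (fun k ↦ T (t k) x) atTop (𝓝 (T 0 x)) := hcont.tendsto.comp
      (tendsto_nhdsWithin_iff.2 ⟨htend, .of_forall fun k ↦ (ht k).1⟩)
    obtain ⟨C, hC⟩ := (Metric.isBounded_range_of_tendsto _ hlim).exists_norm_le
    exact ⟨C, fun k ↦ hC _ (mem_range_self k)⟩
  obtain ⟨C, hC⟩ := banach_steinhaus hpointwise
  obtain ⟨k, hk⟩ := exists_nat_gt C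
  linarith [hC k, htk k]

theorem continuousOn_orbit (hT : IsC0Semigroup T) {δ C : ℝ} (hC : 0 < C)
    (hb : ∀ t ∈ Icc 0 δ, ‖T t‖ ≤ C) (x : X) : ContinuousOn (fun t ↦ T t x) (Icc 0 δ) := by
  have hdist : ∀ s ∈ Icc 0 δ, ∀ t ∈ Icc 0 δ, s < t →
      dist (T s x) (T t x) ≤ C * ‖T (t - s) x - x‖ := by
    intro s hs t _ hst
    have hsplit := hT.apply_add hs.1 (sub_nonneg.2 hst.le) x
    rw [add_sub_cancel] at hsplit
    rw [dist_comm, dist_eq_norm, hsplit, ← map_sub]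
    exact (T s).le_of_opNorm_le (hb s hs) _
  rw [Metric.continuousOn_iff]
  intro t ht ε hε
  obtain ⟨η, hη, hclose⟩ := Metric.tendsto_nhdsWithin_nhds.1 (hT.strongly_continuous x) (ε / C)
    (by positivity)
  have hsmall : ∀ h, 0 < h → h < η → C * ‖T h x - x‖ < ε := fun h h0 h1 ↦ by
    have hd := hclose (x := h) h0 (by rwa [Real.dist_eq, sub_zero, abs_of_pos h0])
    rwa [dist_eq_norm, lt_div_iff₀' hC] at hd
  refine ⟨η, hη, fun s hs hst ↦ ?_⟩
  obtain ⟨hl, hr⟩ := abs_lt.1 (Real.dist_eq s t ▸ hst)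
  rcases lt_trichotomy s t with h | rfl | h
  · exact (hdist s hs t ht h).trans_lt (hsmall _ (by linarith) (by linarith))
  · simpa using hε
  · rw [dist_comm]
    exact (hdist t ht s hs h).trans_lt (hsmall _ (by linarith) hr)

end IsC0Semigroup

variable [NormedSpace ℝ X]

/-- The Laplace transform of the orbit of `x`, truncated at time `τ`: an approximation of
`(l - A)⁻¹ x` for the generator `A` of `T`. -/
def truncatedResolvent (T : ℝ → X →L[𝕜] X) (l τ : ℝ) (x : X) : X :=
  ∫ s in (0 : ℝ)..τ, Real.exp (-(l * s)) • T s x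

theorem norm_truncatedResolvent_le {T : ℝ → X →L[𝕜] X} {l τ C : ℝ} (hl : 0 < l) (hτ : 0 ≤ τ)
    (hC : 0 ≤ C) (hb : ∀ t ∈ Icc 0 τ, ‖T t‖ ≤ C) (x : X) :
    ‖truncatedResolvent T l τ x‖ ≤ C / l * ‖x‖ := by
  have hint : ∫ s in (0 : ℝ)..τ, Real.exp (-(l * s)) * (C * ‖x‖) =
      (1 - Real.exp (-(l * τ))) * (C / l * ‖x‖) := by
    have hprim (s : ℝ) : HasDerivAt (fun s ↦ -Real.exp (-(l * s)) * (C / l * ‖x‖))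
        (Real.exp (-(l * s)) * (C * ‖x‖)) s := by
      refine (((hasDerivAt_id s).const_mul l).neg.exp.neg.mul_const _).congr_deriv ?_
      simp only [Pi.neg_apply, id_eq]
      field_simp
    rw [intervalIntegral.integral_eq_sub_of_hasDerivAt (fun s _ ↦ hprim s)
      (Continuous.intervalIntegrable (by fun_prop) _ _)]
    simp only [mul_zero, neg_zero, Real.exp_zero]
    ring
  calc ‖truncatedResolvent T l τ x‖ ≤ ∫ s in (0 : ℝ)..τ, Real.exp (-(l * s)) * (C * ‖x‖) := by
        refine intervalIntegral.norm_integral_le_of_norm_le hτ (.of_forall fun s hs ↦ ?_)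
          (Continuous.intervalIntegrable (by fun_prop) _ _)
        rw [norm_smul, Real.norm_eq_abs, Real.abs_exp]
        gcongr
        exact (T s).le_of_opNorm_le (hb s (Ioc_subset_Icc_self hs)) x
    _ ≤ C / l * ‖x‖ := by
        rw [hint]
        exact mul_le_of_le_one_left (by positivity)
          (sub_le_self _ (Real.exp_pos _).le)

theorem norm_le_of_eq_truncatedResolvent {T : ℝ → X →L[𝕜] X} {l τ C : ℝ} (hl : 0 < l)
    (hτ : 0 ≤ τ) (hC : 0 ≤ C) (hb : ∀ t ∈ Icc 0 τ, ‖T t‖ ≤ C) {B : X →L[𝕜] X}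
    {Φ E : X →L[𝕜] 𝕜}
    (hΦ : ∀ x, Φ x = Real.exp (-(l * τ)) • Φ (T τ x) +
      (E (truncatedResolvent T l τ x) - Φ (B (truncatedResolvent T l τ x)))) :
    ‖Φ‖ ≤ Real.exp (-(l * τ)) * (‖Φ‖ * C) + (‖E‖ + ‖Φ‖ * ‖B‖) * (C / l) := by
  refine Φ.opNorm_le_bound (by positivity) fun x ↦ ?_
  have hR := norm_truncatedResolvent_le hl hτ hC hb x
  have hTx := (T τ).le_of_opNorm_le (hb τ ⟨hτ, le_rfl⟩) x
  set R := truncatedResolvent T l τ x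
  calc ‖Φ x‖ ≤ Real.exp (-(l * τ)) * ‖Φ (T τ x)‖ + ‖(E - Φ.comp B) R‖ := by
        rw [hΦ x]
        refine (norm_add_le _ _).trans_eq ?_
        rw [norm_smul, Real.norm_eq_abs, Real.abs_exp]
        rfl
    _ ≤ Real.exp (-(l * τ)) * (‖Φ‖ * (C * ‖x‖)) + (‖E‖ + ‖Φ‖ * ‖B‖) * (C / l * ‖x‖) := by
        gcongr
        · exact Φ.le_opNorm_of_le hTx
        · refine ContinuousLinearMap.le_of_opNorm_le_of_le _ ?_ hR
          exact (norm_sub_le _ _).trans (by gcongr; exact Φ.opNorm_comp_le B)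
    _ = _ := by ring

variable [CompleteSpace X]

theorem hasDerivAt_exp_smul_integral_window {F : ℝ → X} (hF : Continuous F) (l τ : ℝ) :
    HasDerivAt (fun h ↦ Real.exp (l * h) • ∫ s in h..τ + h, F s)
      (l • (∫ s in (0 : ℝ)..τ, F s) + F τ - F 0) 0 := by
  have hprim (t : ℝ) : HasDerivAt (fun t ↦ ∫ s in (0 : ℝ)..t, F s) (F t) t :=
    intervalIntegral.integral_hasDerivAt_right (hF.intervalIntegrable 0 t)
      hF.stronglyMeasurable.stronglyMeasurableAtFilter hF.continuousAt
  have hright : HasDerivAt (fun h ↦ ∫ s in (0 : ℝ)..τ + h, F s) (F τ) 0 :=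
    (((add_zero τ).symm ▸ hprim τ).comp_const_add τ 0).congr_deriv (by rw [add_zero])
  refine ((((hasDerivAt_id (0 : ℝ)).const_mul l).exp.smul (hright.sub (hprim 0))).congr_deriv
    (by
      simp only [id_eq, mul_zero, Real.exp_zero, one_smul, mul_one, one_mul, Pi.sub_apply,
        add_zero, intervalIntegral.integral_same, sub_zero]
      abel)).congr_of_eventuallyEq (.of_forall fun h ↦ ?_)
  simp only [id_eq, Pi.smul_apply', Pi.sub_apply, intervalIntegral.integral_interval_sub_left
    (hF.intervalIntegrable _ _) (hF.intervalIntegrable _ _)]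

variable [IsScalarTower ℝ 𝕜 X]

theorem IsC0Semigroup.apply_truncatedResolvent {T : ℝ → X →L[𝕜] X} (hT : IsC0Semigroup T)
    {τ h : ℝ} {x : X} (hτ : 0 ≤ τ) (hh : 0 ≤ h) (hcont : ContinuousOn (fun t ↦ T t x) (Icc 0 τ))
    (l : ℝ) :
    T h (truncatedResolvent T l τ x) =
      Real.exp (l * h) • ∫ s in h..τ + h, Real.exp (-(l * s)) • T s x := by
  have hshift := intervalIntegral.integral_comp_add_right (a := 0) (b := τ)
    (fun s ↦ Real.exp (-(l * s)) • T s x) h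
  rw [zero_add] at hshift
  rw [truncatedResolvent, ← ContinuousLinearMap.intervalIntegral_comp_comm, ← hshift,
    ← intervalIntegral.integral_smul]
  · refine intervalIntegral.integral_congr fun s hs ↦ ?_
    rw [uIcc_of_le hτ] at hs
    rw [smul_smul, ← Real.exp_add, add_comm s h, hT.apply_add hh hs.1,
      ContinuousLinearMap.map_smul_of_tower]
    congr 2
    ring
  · refine ContinuousOn.intervalIntegrable ?_
    rw [uIcc_of_le hτ]
    exact (by fun_prop : Continuous fun s ↦ Real.exp (-(l * s))).continuousOn.smul hcont

theorem IsC0Semigroup.tendsto_truncatedResolvent {T : ℝ → X →L[𝕜] X} (hT : IsC0Semigroup T)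
    {δ τ : ℝ} {x : X} (hcont : ContinuousOn (fun t ↦ T t x) (Icc 0 δ)) (hτ : 0 ≤ τ) (hτδ : τ < δ)
    (l : ℝ) :
    Tendsto (fun h : ℝ ↦ (h : 𝕜)⁻¹ •
        (T h (truncatedResolvent T l τ x) - truncatedResolvent T l τ x)) (𝓝[>] 0)
      (𝓝 (l • truncatedResolvent T l τ x + Real.exp (-(l * τ)) • T τ x - x)) := by
  have hδ : 0 ≤ δ := hτ.trans hτδ.le
  set F : ℝ → X := fun s ↦ Real.exp (-(l * s)) • IccExtend hδ ((Icc 0 δ).domRestrict (T · x)) s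
  have hFc : Continuous F := (by fun_prop : Continuous fun s ↦ Real.exp (-(l * s))).smul
    hcont.domRestrict.Icc_extend'
  have hF : ∀ s ∈ Icc 0 δ, F s = Real.exp (-(l * s)) • T s x := fun s hs ↦ by
    simp only [F, IccExtend_of_mem hδ _ hs, domRestrict_apply]
  have hwindow : ∀ h ∈ Icc 0 (δ - τ), T h (truncatedResolvent T l τ x) =
      Real.exp (l * h) • ∫ s in h..τ + h, F s := by
    intro h hh
    rw [hT.apply_truncatedResolvent hτ hh.1 (hcont.mono (Icc_subset_Icc_right hτδ.le))]
    refine congrArg _ (intervalIntegral.integral_congr fun s hs ↦ (hF s ?_).symm)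
    rw [uIcc_of_le (by linarith)] at hs
    exact ⟨hh.1.trans hs.1, by linarith [hs.2, hh.2]⟩
  have hzero : truncatedResolvent T l τ x = ∫ s in (0 : ℝ)..τ, F s := by
    simpa [hT.map_zero] using hwindow 0 ⟨le_rfl, sub_nonneg.2 hτδ.le⟩
  have hlim := (hasDerivAt_exp_smul_integral_window hFc l τ).tendsto_slope_zero_right
  rw [← hzero, hF τ ⟨hτ, hτδ.le⟩, hF 0 ⟨le_rfl, hδ⟩] at hlim
  simp only [hT.map_zero, ContinuousLinearMap.id_apply, mul_zero, neg_zero, Real.exp_zero,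
    one_smul, zero_add, add_zero, ← hzero] at hlim
  refine hlim.congr' ?_
  filter_upwards [Ioo_mem_nhdsGT (sub_pos.2 hτδ)] with h hh
  rw [hwindow h ⟨hh.1.le, hh.2.le⟩, ← RCLike.ofReal_inv, ← RCLike.real_smul_eq_coe_smul]

theorem GeneratesC0Semigroup.exists_functional_bound {A : X → X → Prop}
    (hA : GeneratesC0Semigroup 𝕜 A) (B : X →L[𝕜] X) :
    ∃ C : ℝ, ∀ᶠ l : ℝ in atTop, ∀ Φ E : X →L[𝕜] 𝕜,
      (∀ x z, A x z → Φ z = (l : 𝕜) * Φ x - E x + Φ (B x)) → l * ‖Φ‖ ≤ C * ‖E‖ := by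
  obtain ⟨T, hT, hAT⟩ := hA
  obtain ⟨δ, hδ, C, hC, hb⟩ := hT.exists_norm_le
  set τ : ℝ := δ / 2
  have hτ : 0 < τ := half_pos hδ
  have hτδ : τ < δ := half_lt_self hδ
  have hbτ : ∀ t ∈ Icc 0 τ, ‖T t‖ ≤ C := fun t ht ↦ hb t ⟨ht.1, ht.2.trans hτδ.le⟩
  refine ⟨2 * C, ?_⟩
  have hlim : Tendsto (fun l : ℝ ↦ Real.exp (-(l * τ)) * C + C / l * ‖B‖) atTop (𝓝 0) := by
    have hexp : Tendsto (fun l : ℝ ↦ Real.exp (-(l * τ))) atTop (𝓝 0) :=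
      Real.tendsto_exp_neg_atTop_nhds_zero.comp (tendsto_id.atTop_mul_const hτ)
    simpa using (hexp.mul_const C).add
      ((tendsto_const_nhds (x := C).div_atTop tendsto_id).mul_const ‖B‖)
  filter_upwards [hlim.eventually_lt_const (half_pos one_pos), eventually_gt_atTop 0]
    with l hl hl0 Φ E hΦ
  have hrep (x : X) : Φ x = Real.exp (-(l * τ)) • Φ (T τ x) +
      (E (truncatedResolvent T l τ x) - Φ (B (truncatedResolvent T l τ x))) := by
    have hgraph := hΦ _ _ ((hAT _ _).2
      (hT.tendsto_truncatedResolvent (hT.continuousOn_orbit hC hb x) hτ.le hτδ l))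
    rw [map_sub, map_add, ContinuousLinearMap.map_smul_of_tower,
      ContinuousLinearMap.map_smul_of_tower, RCLike.real_smul_eq_coe_mul (K := 𝕜) l]
      at hgraph
    linear_combination -hgraph
  have hΦle := norm_le_of_eq_truncatedResolvent hl0 hτ.le hC.le hbτ hrep
  have hhalf : ‖Φ‖ ≤ 2 * (C / l * ‖E‖) := by nlinarith [norm_nonneg Φ]
  calc l * ‖Φ‖ ≤ l * (2 * (C / l * ‖E‖)) := by gcongr
    _ = 2 * C * ‖E‖ := by field_simp

end Semigroup

section LpOperators

variable {𝕜 : Type*} [RCLike 𝕜] {n : ℕ} {α : Type*} [MeasurableSpace α] {μ : Measure α}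

theorem matAct_apply (M : Matrix (Fin n) (Fin n) 𝕜) (w : KVec 𝕜 n) (i : Fin n) :
    matAct M w i = ∑ j, M i j * w j := rfl

theorem matAct_eq_toEuclideanCLM (M : Matrix (Fin n) (Fin n) 𝕜) (w : KVec 𝕜 n) :
    matAct M w = Matrix.toEuclideanCLM (𝕜 := 𝕜) M w := rfl

theorem matAct_mul (M N : Matrix (Fin n) (Fin n) 𝕜) (w : KVec 𝕜 n) :
    matAct (M * N) w = matAct M (matAct N w) := by
  simp only [matAct_eq_toEuclideanCLM, map_mul, mul_apply_eq_comp]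

theorem norm_matAct_le (M : Matrix (Fin n) (Fin n) 𝕜) (w : KVec 𝕜 n) :
    ‖matAct M w‖ ≤ ‖Matrix.toEuclideanCLM (𝕜 := 𝕜) M‖ * ‖w‖ :=
  ContinuousLinearMap.le_opNorm (Matrix.toEuclideanCLM (𝕜 := 𝕜) M) w

theorem memLp_toEuclideanCLM {p : ENNReal} {B : α → Matrix (Fin n) (Fin n) 𝕜}
    (hB : ∀ i j, MemLp (fun ξ ↦ B ξ i j) p μ) :
    MemLp (fun ξ ↦ Matrix.toEuclideanCLM (𝕜 := 𝕜) (B ξ)) p μ := by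
  have hB' : MemLp (fun ξ i j ↦ B ξ i j) p μ := .of_eval fun i ↦ .of_eval fun j ↦ hB i j
  let L : (Fin n → Fin n → 𝕜) →ₗ[𝕜] KVec 𝕜 n →L[𝕜] KVec 𝕜 n :=
    (Matrix.toEuclideanCLM (𝕜 := 𝕜) (n := Fin n)).toAlgEquiv.toLinearMap
  exact L.toContinuousLinearMap.comp_memLp' hB'

/-- The operator `x ↦ B x` on `L^p` of pointwise multiplication by an essentially bounded matrix
function `B`. -/
def matMulLp (p : ENNReal) [Fact (1 ≤ p)] (B : α → Matrix (Fin n) (Fin n) 𝕜)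
    (hB : ∀ i j, MemLp (fun ξ ↦ B ξ i j) ⊤ μ) :
    Lp (KVec 𝕜 n) p μ →L[𝕜] Lp (KVec 𝕜 n) p μ :=
  (ContinuousLinearMap.id 𝕜 (KVec 𝕜 n →L[𝕜] KVec 𝕜 n)).holderL μ ⊤ p p
    (memLp_toEuclideanCLM hB).toLp

theorem matMulLp_ae_eq {p : ENNReal} [Fact (1 ≤ p)] {B : α → Matrix (Fin n) (Fin n) 𝕜}
    (hB : ∀ i j, MemLp (fun ξ ↦ B ξ i j) ⊤ μ) (x : Lp (KVec 𝕜 n) p μ) :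
    ∀ᵐ ξ ∂μ, matMulLp p B hB x ξ = matAct (B ξ) (x ξ) := by
  filter_upwards [ContinuousLinearMap.coeFn_holder (r := p)
    (ContinuousLinearMap.id 𝕜 (KVec 𝕜 n →L[𝕜] KVec 𝕜 n)) (memLp_toEuclideanCLM hB).toLp x,
    (memLp_toEuclideanCLM hB).coeFn_toLp] with ξ hξ hBξ
  rw [matAct_eq_toEuclideanCLM, ← hBξ]
  exact hξ

theorem matMulLp_leftInverse {p : ENNReal} [Fact (1 ≤ p)] {B C : α → Matrix (Fin n) (Fin n) 𝕜}
    (hB : ∀ i j, MemLp (fun ξ ↦ B ξ i j) ⊤ μ) (hC : ∀ i j, MemLp (fun ξ ↦ C ξ i j) ⊤ μ)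
    (hBC : ∀ᵐ ξ ∂μ, B ξ * C ξ = 1) :
    Function.LeftInverse (matMulLp p B hB) (matMulLp p C hC) := fun x ↦ by
  refine Lp.ext ?_
  filter_upwards [matMulLp_ae_eq hB (matMulLp p C hC x), matMulLp_ae_eq hC x, hBC]
    with ξ hBx hCx hξ
  rw [hBx, hCx, ← matAct_mul, hξ, matAct_eq_toEuclideanCLM, map_one, one_apply_eq_self]

theorem memLp_coord {p : ENNReal} (x : Lp (KVec 𝕜 n) p μ) (i : Fin n) :
    MemLp (fun ξ ↦ x ξ i) p μ :=
  (EuclideanSpace.proj (𝕜 := 𝕜) i).comp_memLp' (Lp.memLp x)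

variable [IsFiniteMeasure μ]

theorem integrable_mul_coord {p : ENNReal} [hp : Fact (1 ≤ p)] {θ : α → 𝕜} (hθ : MemLp θ ⊤ μ)
    (x : Lp (KVec 𝕜 n) p μ) (i : Fin n) : Integrable (fun ξ ↦ θ ξ * x ξ i) μ :=
  memLp_one_iff_integrable.1 (((memLp_coord x i).mono_exponent hp.out).mul hθ)

/-- The bounded functional `x ↦ ∫ θ xᵢ` on `L^p` given by an essentially bounded function `θ` on a
finite measure space. -/
def coordPairing (p : ENNReal) [Fact (1 ≤ p)] (θ : α → 𝕜) (hθ : MemLp θ ⊤ μ) (i : Fin n) :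
    Lp (KVec 𝕜 n) p μ →L[𝕜] 𝕜 :=
  haveI : p.conjExponent.HolderConjugate p := (ENNReal.HolderConjugate.conjExponent Fact.out).symm
  haveI : Fact (1 ≤ p.conjExponent) := ⟨ENNReal.HolderConjugate.one_le _ p⟩
  ((ContinuousLinearMap.mul 𝕜 𝕜).bilinearComp (.id 𝕜 𝕜) (EuclideanSpace.proj i)).lpPairing
    μ p.conjExponent p (hθ.mono_exponent le_top).toLp

theorem coordPairing_apply {p : ENNReal} [Fact (1 ≤ p)] {θ : α → 𝕜} (hθ : MemLp θ ⊤ μ)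
    (i : Fin n) (x : Lp (KVec 𝕜 n) p μ) : coordPairing p θ hθ i x = ∫ ξ, θ ξ * x ξ i ∂μ := by
  rw [coordPairing, ContinuousLinearMap.lpPairing_eq_integral]
  refine integral_congr_ae ?_
  filter_upwards [(hθ.mono_exponent le_top : MemLp θ p.conjExponent μ).coeFn_toLp] with ξ hξ
  rw [hξ]
  rfl

end LpOperators

section MatrixFunctions

variable {𝕜 : Type*} [RCLike 𝕜] {n : ℕ}

theorem memLp_top_of_continuousOn_Icc {E : Type*} [NormedAddCommGroup E] {a b : ℝ} {f : ℝ → E}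
    (hf : ContinuousOn f (Icc a b)) : MemLp f ⊤ (volume.restrict (Icc a b)) := by
  obtain ⟨C, hC⟩ := isCompact_Icc.exists_bound_of_continuousOn hf
  refine memLp_top_of_bound (hf.aestronglyMeasurable_of_isCompact isCompact_Icc measurableSet_Icc)
    C ?_
  filter_upwards [ae_restrict_mem measurableSet_Icc] with x hx using hC x hx

theorem memLp_top_matrix_mul {α : Type*} [MeasurableSpace α] {μ : Measure α}
    {A B : α → Matrix (Fin n) (Fin n) 𝕜} (hA : ∀ i j, MemLp (fun x ↦ A x i j) ⊤ μ)
    (hB : ∀ i j, MemLp (fun x ↦ B x i j) ⊤ μ) (i j : Fin n) :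
    MemLp (fun x ↦ (A x * B x) i j) ⊤ μ := by
  simp only [Matrix.mul_apply]
  exact memLp_finsetSum _ fun k _ ↦ (hB k j).mul' (hA i k)

theorem continuousOn_matrix_inv_apply {X : Type*} [TopologicalSpace X] {s : Set X}
    {S : X → Matrix (Fin n) (Fin n) 𝕜} (hS : ∀ i j, ContinuousOn (fun x ↦ S x i j) s)
    (hu : ∀ x ∈ s, IsUnit (S x)) (i j : Fin n) : ContinuousOn (fun x ↦ (S x)⁻¹ i j) s := by
  have hS' : ContinuousOn S s := continuousOn_pi.2 fun i ↦ continuousOn_pi.2 (hS i)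
  simp only [Matrix.inv_def, Ring.inverse_eq_inv', Matrix.smul_apply, smul_eq_mul]
  refine (ContinuousOn.inv₀ (continuous_id.matrix_det.comp_continuousOn hS') fun x hx ↦ ?_).mul
    ((continuous_id.matrix_adjugate.matrix_elem i j).comp_continuousOn hS')
  exact ((Matrix.isUnit_iff_isUnit_det _).1 (hu x hx)).ne_zero

end MatrixFunctions

namespace HBCS

variable {𝕜 : Type*} [RCLike 𝕜] {n : ℕ} {Sys : HBCS 𝕜 n}

instance : IsFiniteMeasure Sys.measure := by
  rw [HBCS.measure]
  infer_instance

theorem integral_measure {E : Type*} [NormedAddCommGroup E] [NormedSpace ℝ E] (f : ℝ → E) :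
    ∫ ξ, f ξ ∂Sys.measure = ∫ ξ in Sys.a..Sys.b, f ξ := by
  rw [measure, integral_Icc_eq_integral_Ioc, intervalIntegral.integral_of_le Sys.hab.le]

/-- A diagonalisation `S P₁ H = Λ S` of the principal part, `Λ = diag(σ i * speed i)`. In the
characteristic variables `S x` the system is a family of transport equations coupled only through
terms of order zero; the `i`-th one travels towards `a` if `σ i = 1` and towards `b` if
`σ i = -1`. -/
structure CharForm (Sys : HBCS 𝕜 n) where
  S : ℝ → Matrix (Fin n) (Fin n) 𝕜
  σ : Fin n → ℝ
  speed : Fin n → ℝ → ℝ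
  contDiffOn_S : ∀ i j, ContDiffOn ℝ 1 (fun ξ ↦ S ξ i j) (Icc Sys.a Sys.b)
  isUnit_S : ∀ ξ ∈ Icc Sys.a Sys.b, IsUnit (S ξ)
  σ_eq : ∀ i, σ i = 1 ∨ σ i = -1
  continuousOn_speed : ∀ i, ContinuousOn (speed i) (Icc Sys.a Sys.b)
  speed_pos : ∀ i, ∀ ξ ∈ Icc Sys.a Sys.b, 0 < speed i ξ
  diagonalises : ∀ᵐ ξ ∂Sys.measure, S ξ * Sys.P₁ * Sys.H ξ =
    Matrix.diagonal (fun i ↦ ((σ i * speed i ξ : ℝ) : 𝕜)) * S ξ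

theorem DiagonalisationAssumption.nonempty_charForm (hD : Sys.DiagonalisationAssumption) :
    Nonempty Sys.CharForm := by
  obtain ⟨S, HD, m, -, hS, hHD, hSu, hHDp, hP⟩ := hD
  have hpos (i : Fin n) (ξ : ℝ) (hξ : ξ ∈ Icc Sys.a Sys.b) : 0 < HD ξ i i :=
    (hHDp ξ hξ).2.diag_pos
  refine ⟨{
    S := S
    σ := fun i ↦ if i.val < m then 1 else -1
    speed := fun i ξ ↦ RCLike.re (HD ξ i i)
    contDiffOn_S := hS
    isUnit_S := hSu
    σ_eq := fun i ↦ ite_eq_or_eq _ _ _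
    continuousOn_speed := fun i ↦ RCLike.continuous_re.comp_continuousOn (hHD i i).continuousOn
    speed_pos := fun i ξ hξ ↦ (RCLike.pos_iff.1 (hpos i ξ hξ)).1
    diagonalises := ?_ }⟩
  filter_upwards [hP, ae_restrict_mem measurableSet_Icc] with ξ hPξ hξ
  have hdiag : Matrix.diagonal (fun i : Fin n ↦ if i.val < m then (1 : 𝕜) else -1) * HD ξ =
      Matrix.diagonal fun i : Fin n ↦
        (((if i.val < m then 1 else -1) * RCLike.re (HD ξ i i) : ℝ) : 𝕜) := by
    rw [← (hHDp ξ hξ).1.diagonal_diag, Matrix.diagonal_mul_diagonal]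
    congr 1 with i
    have hre : ((RCLike.re (HD ξ i i) : ℝ) : 𝕜) = HD ξ i i :=
      RCLike.conj_eq_iff_re.1 (RCLike.conj_eq_iff_im.2 (RCLike.pos_iff.1 (hpos i ξ hξ)).2)
    rw [RCLike.ofReal_mul, Matrix.diag_apply, Matrix.diagonal_apply_eq, Matrix.diag_apply, hre]
    split_ifs <;> simp
  rw [Matrix.mul_assoc, hPξ, ← hdiag, Matrix.mul_assoc (S ξ)⁻¹, Matrix.mul_assoc (S ξ)⁻¹,
    Matrix.mul_nonsing_inv_cancel_left _ _ ((Matrix.isUnit_iff_isUnit_det _).1 (hSu ξ hξ))]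

namespace CharForm

variable (cf : Sys.CharForm)

theorem memLp_S (i j : Fin n) : MemLp (fun ξ ↦ cf.S ξ i j) ⊤ Sys.measure :=
  memLp_top_of_continuousOn_Icc (cf.contDiffOn_S i j).continuousOn

theorem memLp_S_inv (i j : Fin n) : MemLp (fun ξ ↦ (cf.S ξ)⁻¹ i j) ⊤ Sys.measure :=
  memLp_top_of_continuousOn_Icc
    (continuousOn_matrix_inv_apply (fun i j ↦ (cf.contDiffOn_S i j).continuousOn) cf.isUnit_S i j)

/-- The change of state `x ↦ S x` to characteristic variables, as an operator on `L^p`. -/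
def toChar (p : ENNReal) [Fact (1 ≤ p)] : Sys.StateSpace p →L[𝕜] Sys.StateSpace p :=
  matMulLp p cf.S cf.memLp_S

/-- The inverse `X ↦ S⁻¹ X` of `HBCS.CharForm.toChar`. -/
def ofChar (p : ENNReal) [Fact (1 ≤ p)] : Sys.StateSpace p →L[𝕜] Sys.StateSpace p :=
  matMulLp p (fun ξ ↦ (cf.S ξ)⁻¹) cf.memLp_S_inv

theorem isUnit_det_S_ae : ∀ᵐ ξ ∂Sys.measure, IsUnit (cf.S ξ).det := by
  filter_upwards [ae_restrict_mem measurableSet_Icc] with ξ hξ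
  exact (Matrix.isUnit_iff_isUnit_det _).1 (cf.isUnit_S ξ hξ)

variable {p : ENNReal} [hp : Fact (1 ≤ p)]

theorem ofChar_toChar (x : Sys.StateSpace p) : cf.ofChar p (cf.toChar p x) = x :=
  matMulLp_leftInverse _ _
    (by filter_upwards [cf.isUnit_det_S_ae] with ξ hξ using Matrix.nonsing_inv_mul _ hξ) x

theorem toChar_ofChar (x : Sys.StateSpace p) : cf.toChar p (cf.ofChar p x) = x :=
  matMulLp_leftInverse _ _
    (by filter_upwards [cf.isUnit_det_S_ae] with ξ hξ using Matrix.mul_nonsing_inv _ hξ) x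

/-- The entrywise derivative of `S` on `[a, b]`, one-sided at the ends. -/
def derivS (ξ : ℝ) : Matrix (Fin n) (Fin n) 𝕜 :=
  Matrix.of fun i j ↦ derivWithin (fun ξ ↦ cf.S ξ i j) (Icc Sys.a Sys.b) ξ

theorem continuousOn_derivS (i j : Fin n) :
    ContinuousOn (fun ξ ↦ cf.derivS ξ i j) (Icc Sys.a Sys.b) :=
  (cf.contDiffOn_S i j).continuousOn_derivWithin (uniqueDiffOn_Icc Sys.hab) le_rfl

theorem hasACDeriv_S_mul (M : Matrix (Fin n) (Fin n) 𝕜) (i k : Fin n) :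
    HasACDeriv Sys.a Sys.b (fun ξ ↦ (cf.S ξ * M) i k) (fun ξ ↦ (cf.derivS ξ * M) i k) := by
  simp only [Matrix.mul_apply]
  refine .of_hasDerivWithinAt Sys.hab.le (fun ξ hξ ↦ HasDerivWithinAt.fun_sum fun j _ ↦ ?_)
    (continuousOn_finsetSum _ fun j _ ↦ (cf.continuousOn_derivS i j).mul continuousOn_const)
  exact (((cf.contDiffOn_S i j).differentiableOn one_ne_zero ξ hξ).hasDerivWithinAt).mul_const _

/-- The coefficient `(S P₀ - S' P₁) H` of the terms of order zero in the equation for `S x`,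
expressed in terms of `x`. -/
def lowerOrderCoeff (ξ : ℝ) : Matrix (Fin n) (Fin n) 𝕜 :=
  (cf.S ξ * Sys.P₀ ξ - cf.derivS ξ * Sys.P₁) * Sys.H ξ

theorem memLp_lowerOrderCoeff (hP₀ : ∀ i j, MemLp (fun ξ ↦ Sys.P₀ ξ i j) ⊤ Sys.measure)
    (hH : ∀ i j, MemLp (fun ξ ↦ Sys.H ξ i j) ⊤ Sys.measure) (i j : Fin n) :
    MemLp (fun ξ ↦ cf.lowerOrderCoeff ξ i j) ⊤ Sys.measure := by
  refine memLp_top_matrix_mul (fun i j ↦ ?_) hH i j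
  refine (memLp_top_matrix_mul cf.memLp_S hP₀ i j).sub
    (memLp_top_matrix_mul (fun i j ↦ ?_) (fun i j ↦ memLp_const (Sys.P₁ i j)) i j)
  exact memLp_top_of_continuousOn_Icc (cf.continuousOn_derivS i j)

/-- The characteristic flux `S P₁ v`, where `v` is the continuous representative of `H x`; it
equals `Λ S x` almost everywhere. -/
def flux (v : ℝ → KVec 𝕜 n) (ξ : ℝ) : KVec 𝕜 n :=
  matAct (cf.S ξ * Sys.P₁) (v ξ)

theorem flux_ae_eq {x z : Sys.StateSpace p} {v : ℝ → KVec 𝕜 n} (h : Sys.MaxOperator p x z v) :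
    ∀ᵐ ξ ∂Sys.measure, ∀ i,
      cf.flux v ξ i = ((cf.σ i * cf.speed i ξ : ℝ) : 𝕜) * cf.toChar p x ξ i := by
  obtain ⟨g, -, hv, -⟩ := h
  filter_upwards [hv, cf.diagonalises, matMulLp_ae_eq cf.memLp_S x] with ξ hvξ hdiag hx i
  rw [flux, hvξ, ← matAct_mul, hdiag, matAct_mul, toChar, hx]
  simp only [matAct, Matrix.mulVec_diagonal]

theorem exists_hasACDeriv_flux (hR : ∀ i j, MemLp (fun ξ ↦ cf.lowerOrderCoeff ξ i j) ⊤ Sys.measure)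
    {x z : Sys.StateSpace p} {v : ℝ → KVec 𝕜 n} (h : Sys.MaxOperator p x z v) (i : Fin n) :
    ∃ w' : ℝ → 𝕜, HasACDeriv Sys.a Sys.b (fun ξ ↦ cf.flux v ξ i) w' ∧
      ∀ᵐ ξ ∂Sys.measure, cf.toChar p z ξ i = w' ξ + matMulLp p cf.lowerOrderCoeff hR x ξ i := by
  obtain ⟨g, hvg, hv, hz⟩ := h
  have hvac := hvg.hasACDeriv hp.out Sys.hab.le
  refine ⟨fun ξ ↦ matAct (cf.derivS ξ * Sys.P₁) (v ξ) i + matAct (cf.S ξ * Sys.P₁) (g ξ) i,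
    ?_, ?_⟩
  · simp only [flux, matAct_apply, ← Finset.sum_add_distrib]
    exact HasACDeriv.sum _ fun k _ ↦ (cf.hasACDeriv_S_mul Sys.P₁ i k).mul
      (hvac.clm_comp ((EuclideanSpace.proj (𝕜 := 𝕜) k).restrictScalars ℝ))
  · filter_upwards [hv, hz, matMulLp_ae_eq cf.memLp_S z, matMulLp_ae_eq hR x] with ξ hvξ hzξ hSz hRx
    rw [toChar, hSz, hRx, lowerOrderCoeff, matAct_mul _ (Sys.H ξ), ← hvξ, hzξ]
    simp only [matAct_eq_toEuclideanCLM, map_add, map_sub, map_mul, mul_apply_eq_comp,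
      sub_apply, PiLp.add_apply, PiLp.sub_apply]
    ring

end CharForm

end HBCS

theorem exists_dual_vanishing_on_ker {K U V W : Type*} [Field K] [AddCommGroup U] [Module K U]
    [AddCommGroup V] [Module K V] [AddCommGroup W] [Module K W] [FiniteDimensional K V]
    [FiniteDimensional K W] {f : V →ₗ[K] U} {g : V →ₗ[K] W} (hf : Function.Surjective f)
    (hdim : Module.finrank K V = Module.finrank K U + Module.finrank K W)
    (hfg : ¬Function.Injective (f.prod g)) :
    ∃ β : Module.Dual K W, β ≠ 0 ∧ ∀ v, f v = 0 → β (g v) = 0 := by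
  have hker : Module.finrank K (LinearMap.ker f) = Module.finrank K W := by
    have hrank := f.finrank_range_add_finrank_ker
    rw [LinearMap.range_eq_top.2 hf, finrank_top] at hrank
    omega
  have hrange : LinearMap.range (g.domRestrict (LinearMap.ker f)) < ⊤ := by
    rw [lt_top_iff_ne_top, Ne, LinearMap.range_eq_top,
      ← LinearMap.injective_iff_surjective_of_finrank_eq_finrank hker]
    refine fun hinj ↦ hfg ((injective_iff_map_eq_zero _).2 fun v hv ↦ ?_)
    obtain ⟨hfv, hgv⟩ := Prod.mk.inj hv
    exact congrArg Subtype.val ((injective_iff_map_eq_zero _).1 hinj ⟨v, hfv⟩ hgv)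
  obtain ⟨β, hβ, hle⟩ := Submodule.exists_le_ker_of_lt_top _ hrange
  exact ⟨β, hβ, fun v hv ↦ hle ⟨⟨v, hv⟩, rfl⟩⟩

namespace HBCS

variable {𝕜 : Type*} [RCLike 𝕜] {n : ℕ}

/-- `HBCS.bdryAct` as a linear map on pairs of boundary values `(v b, v a)`. -/
def bdryMap (W : Matrix (Fin n) (Fin n ⊕ Fin n) 𝕜) : KVec 𝕜 n × KVec 𝕜 n →ₗ[𝕜] KVec 𝕜 n :=
  (WithLp.linearEquiv 2 𝕜 (Fin n → 𝕜)).symm ∘ₗ W.mulVecLin ∘ₗ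
    (LinearEquiv.sumArrowLequivProdArrow (Fin n) (Fin n) 𝕜 𝕜).symm ∘ₗ
    ((WithLp.linearEquiv 2 𝕜 (Fin n → 𝕜)).prodCongr
      (WithLp.linearEquiv 2 𝕜 (Fin n → 𝕜))).toLinearMap

theorem bdryMap_surjective {W : Matrix (Fin n) (Fin n ⊕ Fin n) 𝕜} (hW : W.rank = n) :
    Function.Surjective (bdryMap W) := by
  have hsurj : Function.Surjective W.mulVecLin := by
    refine LinearMap.range_eq_top.1 (Submodule.eq_top_of_finrank_eq ?_)
    rw [← Matrix.rank, hW, Module.finrank_fin_fun]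
  simp only [bdryMap, LinearMap.coe_comp, LinearEquiv.coe_coe]
  exact (LinearEquiv.surjective _).comp (hsurj.comp ((LinearEquiv.surjective _).comp
    (LinearEquiv.surjective _)))

theorem exists_norm_bdryAct_le (W : Matrix (Fin n) (Fin n ⊕ Fin n) 𝕜) :
    ∃ c : ℝ, 0 ≤ c ∧ ∀ w₁ w₂, ‖bdryAct W w₁ w₂‖ ≤ c * ‖(w₁, w₂)‖ :=
  ⟨‖(bdryMap W).toContinuousLinearMap‖, norm_nonneg _, fun w₁ w₂ ↦
    (bdryMap W).toContinuousLinearMap.le_opNorm (w₁, w₂)⟩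

variable {Sys : HBCS 𝕜 n}

namespace CharForm

variable (cf : Sys.CharForm)

/-- The end of `[a, b]` through which the `i`-th characteristic variable enters. -/
def inflowEnd (i : Fin n) : ℝ := if cf.σ i = 1 then Sys.b else Sys.a

/-- The end of `[a, b]` through which the `i`-th characteristic variable leaves. -/
def outflowEnd (i : Fin n) : ℝ := if cf.σ i = 1 then Sys.a else Sys.b

theorem outflowEnd_mem (i : Fin n) : cf.outflowEnd i ∈ Icc Sys.a Sys.b := by
  rw [outflowEnd]
  split_ifs
  exacts [left_mem_Icc.2 Sys.hab.le, right_mem_Icc.2 Sys.hab.le]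

theorem σ_smul_sub {E : Type*} [AddCommGroup E] [Module ℝ E] (f : ℝ → E) (i : Fin n) :
    cf.σ i • (f Sys.b - f Sys.a) = f (cf.inflowEnd i) - f (cf.outflowEnd i) := by
  rw [inflowEnd, outflowEnd]
  rcases cf.σ_eq i with h | h
  · simp [h]
  · rw [h, if_neg (by norm_num), if_neg (by norm_num), neg_one_smul, neg_sub]

theorem σ_mul_self (i : Fin n) : cf.σ i * cf.σ i = 1 := by
  rcases cf.σ_eq i with h | h <;> simp [h]

theorem ofReal_σ_mul_self (i : Fin n) : (cf.σ i : 𝕜) * cf.σ i = 1 := by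
  rw [← RCLike.ofReal_mul, σ_mul_self, RCLike.ofReal_one]

/-- The outgoing characteristic fluxes as a linear function of the boundary values
`(v b, v a)`. -/
def outgoing : KVec 𝕜 n × KVec 𝕜 n →ₗ[𝕜] Fin n → 𝕜 :=
  LinearMap.pi fun i ↦ (EuclideanSpace.proj (𝕜 := 𝕜) i).toLinearMap ∘ₗ
    (Matrix.toEuclideanCLM (𝕜 := 𝕜) (cf.S (cf.outflowEnd i) * Sys.P₁)).toLinearMap ∘ₗ
    if cf.σ i = 1 then LinearMap.snd 𝕜 _ _ else LinearMap.fst 𝕜 _ _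

theorem outgoing_apply (v : ℝ → KVec 𝕜 n) (i : Fin n) :
    cf.outgoing (v Sys.b, v Sys.a) i = cf.flux v (cf.outflowEnd i) i := by
  simp only [outgoing, outflowEnd, LinearMap.pi_apply]
  split_ifs <;> rfl

theorem exists_sum_norm_flux_inflowEnd_le :
    ∃ c : ℝ, 0 ≤ c ∧ ∀ v : ℝ → KVec 𝕜 n,
      ∑ i, ‖cf.flux v (cf.inflowEnd i) i‖ ≤ c * ‖(v Sys.b, v Sys.a)‖ := by
  refine ⟨∑ i, ‖Matrix.toEuclideanCLM (𝕜 := 𝕜) (cf.S (cf.inflowEnd i) * Sys.P₁)‖,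
    Finset.sum_nonneg fun _ _ ↦ norm_nonneg _, fun v ↦ ?_⟩
  rw [Finset.sum_mul]
  refine Finset.sum_le_sum fun i _ ↦ (PiLp.norm_apply_le _ i).trans ?_
  refine (norm_matAct_le _ _).trans (mul_le_mul_of_nonneg_left ?_ (norm_nonneg _))
  rw [inflowEnd]
  split_ifs
  exacts [norm_fst_le (v Sys.b, v Sys.a), norm_snd_le (v Sys.b, v Sys.a)]

theorem exists_norm_trace_le (hinj : Function.Injective ((bdryMap Sys.WB).prod cf.outgoing)) :
    ∃ c : ℝ, 0 ≤ c ∧ ∀ v : ℝ → KVec 𝕜 n, ‖(v Sys.b, v Sys.a)‖ ≤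
      c * (‖bdryAct Sys.WB (v Sys.b) (v Sys.a)‖ + ∑ i, ‖cf.flux v (cf.outflowEnd i) i‖) := by
  obtain ⟨K, -, hK⟩ := LinearMap.exists_antilipschitzWith _ (LinearMap.ker_eq_bot.2 hinj)
  refine ⟨K, K.2, fun v ↦ (hK.le_mul_norm (map_zero _) _).trans ?_⟩
  refine mul_le_mul_of_nonneg_left ((norm_prod_le_iff).2 ⟨?_, ?_⟩) K.2
  · exact le_add_of_nonneg_right (Finset.sum_nonneg fun _ _ ↦ norm_nonneg _)
  · refine le_add_of_nonneg_of_le (norm_nonneg _) ?_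
    simp only [← outgoing_apply]
    refine (pi_norm_le_iff_of_nonneg (Finset.sum_nonneg fun _ _ ↦ norm_nonneg _)).2 fun i ↦ ?_
    exact Finset.single_le_sum (f := fun i ↦ ‖cf.outgoing (v Sys.b, v Sys.a) i‖)
      (fun _ _ ↦ norm_nonneg _) (Finset.mem_univ i)

/-- The time that the `i`-th characteristic variable needs to travel across `[a, b]`. -/
def crossingTime (i : Fin n) : ℝ := ∫ s in Sys.a..Sys.b, (cf.speed i s)⁻¹

/-- The time that the `i`-th characteristic variable needs to travel from `ξ` to its outflow
end. -/
def exitTime (i : Fin n) (ξ : ℝ) : ℝ := ∫ s in cf.outflowEnd i..ξ, cf.σ i * (cf.speed i s)⁻¹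

theorem continuousOn_inv_speed (i : Fin n) :
    ContinuousOn (fun ξ ↦ (cf.speed i ξ)⁻¹) (Icc Sys.a Sys.b) :=
  (cf.continuousOn_speed i).inv₀ fun ξ hξ ↦ (cf.speed_pos i ξ hξ).ne'

theorem intervalIntegrable_inv_speed (i : Fin n) :
    IntervalIntegrable (fun ξ ↦ (cf.speed i ξ)⁻¹) volume Sys.a Sys.b :=
  ContinuousOn.intervalIntegrable_of_Icc Sys.hab.le (cf.continuousOn_inv_speed i)

theorem crossingTime_pos (i : Fin n) : 0 < cf.crossingTime i :=
  intervalIntegral.intervalIntegral_pos_of_pos_on (cf.intervalIntegrable_inv_speed i)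
    (fun ξ hξ ↦ inv_pos.2 (cf.speed_pos i ξ (Ioo_subset_Icc_self hξ))) Sys.hab

theorem exitTime_outflowEnd (i : Fin n) : cf.exitTime i (cf.outflowEnd i) = 0 :=
  intervalIntegral.integral_same

theorem exitTime_inflowEnd (i : Fin n) : cf.exitTime i (cf.inflowEnd i) = cf.crossingTime i := by
  rw [exitTime, outflowEnd, inflowEnd, crossingTime, intervalIntegral.integral_const_mul]
  rcases cf.σ_eq i with h | h
  · simp only [h, if_true, one_mul]
  · rw [h, if_neg (by norm_num), if_neg (by norm_num), intervalIntegral.integral_symm, neg_one_mul,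
      neg_neg]

theorem hasDerivWithinAt_exitTime (i : Fin n) {ξ : ℝ} (hξ : ξ ∈ Icc Sys.a Sys.b) :
    HasDerivWithinAt (cf.exitTime i) (cf.σ i * (cf.speed i ξ)⁻¹) (Icc Sys.a Sys.b) ξ := by
  have hcont : ContinuousOn (fun ξ ↦ cf.σ i * (cf.speed i ξ)⁻¹) (Icc Sys.a Sys.b) :=
    (cf.continuousOn_inv_speed i).const_mul _
  have : Fact (ξ ∈ Icc Sys.a Sys.b) := ⟨hξ⟩
  refine intervalIntegral.integral_hasDerivWithinAt_right ?_
    (hcont.stronglyMeasurableAtFilter_nhdsWithin measurableSet_Icc ξ) (hcont ξ hξ)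
  exact (hcont.mono (ordConnected_Icc.uIcc_subset (cf.outflowEnd_mem i) hξ)).intervalIntegrable

/-- A profile equal to `1` at the outflow end and to `0` at the inflow end of the `i`-th
characteristic variable. For large `l` it concentrates at the outflow end, and up to the constant
`HBCS.CharForm.layerDefect` it is an eigenfunction of the adjoint transport operator for the
eigenvalue `l`. -/
def layer (i : Fin n) (l ξ : ℝ) : ℝ :=
  (Real.exp (-(l * cf.exitTime i ξ)) - Real.exp (-(l * cf.crossingTime i))) /
    (1 - Real.exp (-(l * cf.crossingTime i)))

/-- The amount by which `HBCS.CharForm.layer` fails to be an eigenfunction. -/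
def layerDefect (i : Fin n) (l : ℝ) : ℝ :=
  l * Real.exp (-(l * cf.crossingTime i)) / (1 - Real.exp (-(l * cf.crossingTime i)))

theorem tendsto_layerDefect (i : Fin n) : Tendsto (cf.layerDefect i) atTop (𝓝 0) := by
  have hL := cf.crossingTime_pos i
  have hlin : Tendsto (fun l : ℝ ↦ l * cf.crossingTime i) atTop atTop :=
    tendsto_id.atTop_mul_const hL
  have hnum : Tendsto (fun l : ℝ ↦ l * Real.exp (-(l * cf.crossingTime i))) atTop (𝓝 0) := by
    have hscaled := ((Real.tendsto_pow_mul_exp_neg_atTop_nhds_zero 1).comp hlin).const_mul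
      (cf.crossingTime i)⁻¹
    rw [mul_zero] at hscaled
    refine hscaled.congr fun l ↦ ?_
    simp only [Function.comp_apply, pow_one]
    field_simp
  have hden := (Real.tendsto_exp_neg_atTop_nhds_zero.comp hlin).const_sub 1
  have hquot := hnum.div hden (by norm_num)
  rwa [sub_zero, zero_div] at hquot

theorem one_sub_exp_neg_crossingTime_ne_zero (i : Fin n) {l : ℝ} (hl : 0 < l) :
    1 - Real.exp (-(l * cf.crossingTime i)) ≠ 0 :=
  (sub_pos.2 (Real.exp_lt_one_iff.2
    (neg_neg_of_pos (mul_pos hl (cf.crossingTime_pos i))))).ne'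

theorem layer_outflowEnd (i : Fin n) {l : ℝ} (hl : 0 < l) :
    cf.layer i l (cf.outflowEnd i) = 1 := by
  rw [layer, exitTime_outflowEnd, mul_zero, neg_zero, Real.exp_zero,
    div_self (cf.one_sub_exp_neg_crossingTime_ne_zero i hl)]

theorem layer_inflowEnd (i : Fin n) (l : ℝ) : cf.layer i l (cf.inflowEnd i) = 0 := by
  rw [layer, exitTime_inflowEnd, sub_self, zero_div]

theorem continuousOn_layer (i : Fin n) (l : ℝ) :
    ContinuousOn (cf.layer i l) (Icc Sys.a Sys.b) := by
  have hexit : ContinuousOn (cf.exitTime i) (Icc Sys.a Sys.b) := fun ξ hξ ↦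
    (cf.hasDerivWithinAt_exitTime i hξ).continuousWithinAt
  exact ((Real.continuous_exp.comp_continuousOn (hexit.const_mul l).neg).sub
    continuousOn_const).div_const _

theorem hasACDeriv_layer (i : Fin n) {l : ℝ} (hl : 0 < l) :
    HasACDeriv Sys.a Sys.b (cf.layer i l) fun ξ ↦
      -(cf.σ i * (cf.speed i ξ)⁻¹ * (l * cf.layer i l ξ + cf.layerDefect i l)) := by
  refine .of_hasDerivWithinAt Sys.hab.le (fun ξ hξ ↦ ?_)
    (((cf.continuousOn_inv_speed i).const_mul _).mul
      (((cf.continuousOn_layer i l).const_mul l).add continuousOn_const)).neg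
  refine ((((cf.hasDerivWithinAt_exitTime i hξ).const_mul l).neg.exp.sub_const _).div_const
    _).congr_deriv ?_
  have hne := cf.one_sub_exp_neg_crossingTime_ne_zero i hl
  simp only [Pi.neg_apply, layer, layerDefect]
  field_simp
  ring

theorem memLp_layer (i : Fin n) (l : ℝ) :
    MemLp (fun ξ ↦ (cf.layer i l ξ : 𝕜)) ⊤ Sys.measure :=
  memLp_top_of_continuousOn_Icc (RCLike.continuous_ofReal.comp_continuousOn
    (cf.continuousOn_layer i l))

/-- The functional `x ↦ ∫ layer i l * (S x)ᵢ`. Applied to the evolution equation it isolates the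
outgoing flux of the `i`-th characteristic variable. -/
def outflowFunctional (p : ENNReal) [Fact (1 ≤ p)] (i : Fin n) (l : ℝ) : Sys.StateSpace p →L[𝕜] 𝕜 :=
  (coordPairing p _ (cf.memLp_layer i l) i).comp (cf.toChar p)

/-- The functional `x ↦ ∫ (S x)ᵢ`. -/
def meanFunctional (p : ENNReal) [Fact (1 ≤ p)] (i : Fin n) : Sys.StateSpace p →L[𝕜] 𝕜 :=
  (coordPairing p _ (memLp_const 1) i).comp (cf.toChar p)

theorem toChar_ae_eq {p : ENNReal} [Fact (1 ≤ p)] {x z : Sys.StateSpace p} {v : ℝ → KVec 𝕜 n}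
    (h : Sys.MaxOperator p x z v) : ∀ᵐ ξ ∂Sys.measure, ∀ i,
      cf.toChar p x ξ i = ((cf.σ i * (cf.speed i ξ)⁻¹ : ℝ) : 𝕜) * cf.flux v ξ i := by
  filter_upwards [cf.flux_ae_eq h, ae_restrict_mem measurableSet_Icc] with ξ hflux hξ i
  rw [hflux i, ← mul_assoc, ← RCLike.ofReal_mul, mul_mul_mul_comm, σ_mul_self,
    inv_mul_cancel₀ (cf.speed_pos i ξ hξ).ne', mul_one, RCLike.ofReal_one, one_mul]

theorem integral_mul_flux_by_parts {p : ENNReal} [Fact (1 ≤ p)]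
    (hR : ∀ i j, MemLp (fun ξ ↦ cf.lowerOrderCoeff ξ i j) ⊤ Sys.measure)
    {x z : Sys.StateSpace p} {v : ℝ → KVec 𝕜 n} (h : Sys.MaxOperator p x z v) (i : Fin n)
    {θ θ' : ℝ → 𝕜} (hθ : HasACDeriv Sys.a Sys.b θ θ') :
    ∫ ξ, (θ' ξ * cf.flux v ξ i + θ ξ * (cf.toChar p z ξ i -
        matMulLp p cf.lowerOrderCoeff hR x ξ i)) ∂Sys.measure =
      cf.σ i * (θ (cf.inflowEnd i) * cf.flux v (cf.inflowEnd i) i -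
        θ (cf.outflowEnd i) * cf.flux v (cf.outflowEnd i) i) := by
  obtain ⟨w', hw, hz⟩ := cf.exists_hasACDeriv_flux hR h i
  have hderiv : ∫ ξ, (θ' ξ * cf.flux v ξ i + θ ξ * (cf.toChar p z ξ i -
      matMulLp p cf.lowerOrderCoeff hR x ξ i)) ∂Sys.measure =
      ∫ ξ, (θ' ξ * cf.flux v ξ i + θ ξ * w' ξ) ∂Sys.measure := by
    refine integral_congr_ae ?_
    filter_upwards [hz] with ξ hξ
    rw [hξ, add_sub_cancel_right]
  rw [hderiv, integral_measure, (hθ.mul hw).integral_eq_sub Sys.hab.le,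
    ← cf.σ_smul_sub fun ξ ↦ θ ξ * cf.flux v ξ i, ← RCLike.real_smul_eq_coe_mul, smul_smul,
    σ_mul_self, one_smul]

theorem outflowFunctional_apply_of_maxOperator {p : ENNReal} [Fact (1 ≤ p)]
    (hR : ∀ i j, MemLp (fun ξ ↦ cf.lowerOrderCoeff ξ i j) ⊤ Sys.measure) (i : Fin n) {l : ℝ}
    (hl : 0 < l) {x z : Sys.StateSpace p} {v : ℝ → KVec 𝕜 n} (h : Sys.MaxOperator p x z v) :
    cf.outflowFunctional p i l z = l * cf.outflowFunctional p i l x +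
      cf.layerDefect i l * cf.meanFunctional p i x +
      cf.outflowFunctional p i l (cf.ofChar p (matMulLp p cf.lowerOrderCoeff hR x)) -
      cf.σ i * cf.flux v (cf.outflowEnd i) i := by
  have hparts := cf.integral_mul_flux_by_parts hR h i
    ((cf.hasACDeriv_layer i hl).clm_comp (RCLike.ofRealCLM (K := 𝕜)))
  simp only [RCLike.ofRealCLM_apply, layer_outflowEnd _ _ hl, layer_inflowEnd, RCLike.ofReal_one,
    RCLike.ofReal_zero, one_mul, zero_mul, zero_sub] at hparts
  have hsplit : (fun ξ ↦ ((-(cf.σ i * (cf.speed i ξ)⁻¹ *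
        (l * cf.layer i l ξ + cf.layerDefect i l)) : ℝ) : 𝕜) * cf.flux v ξ i +
        (cf.layer i l ξ : 𝕜) *
          (cf.toChar p z ξ i - matMulLp p cf.lowerOrderCoeff hR x ξ i)) =ᵐ[Sys.measure]
      (fun ξ ↦ (cf.layer i l ξ : 𝕜) * cf.toChar p z ξ i) -
        (fun ξ ↦ (l : 𝕜) * ((cf.layer i l ξ : 𝕜) * cf.toChar p x ξ i)) -
        (fun ξ ↦ (cf.layerDefect i l : 𝕜) * (1 * cf.toChar p x ξ i)) -
        fun ξ ↦ (cf.layer i l ξ : 𝕜) * matMulLp p cf.lowerOrderCoeff hR x ξ i := by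
    filter_upwards [cf.toChar_ae_eq h] with ξ hξ
    simp only [Pi.sub_apply, hξ i]
    push_cast
    ring
  have hlayer (X : Sys.StateSpace p) := integrable_mul_coord (cf.memLp_layer i l) X i
  have hmean := integrable_mul_coord (memLp_const (1 : 𝕜)) (cf.toChar p x) i
  rw [integral_congr_ae hsplit,
    integral_sub' (((hlayer _).sub ((hlayer _).const_mul _)).sub (hmean.const_mul _)) (hlayer _),
    integral_sub' ((hlayer _).sub ((hlayer _).const_mul _)) (hmean.const_mul _),
    integral_sub' (hlayer _) ((hlayer _).const_mul _), integral_const_mul, integral_const_mul]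
    at hparts
  simp only [outflowFunctional, meanFunctional, ContinuousLinearMap.comp_apply, toChar_ofChar,
    coordPairing_apply]
  linear_combination hparts

theorem integral_layer_div_speed (i : Fin n) {l : ℝ} (hl : 0 < l) :
    l * ∫ ξ in Sys.a..Sys.b, cf.layer i l ξ * (cf.speed i ξ)⁻¹ =
      1 - cf.layerDefect i l * cf.crossingTime i := by
  have hint : IntervalIntegrable (fun ξ ↦ cf.layer i l ξ * (cf.speed i ξ)⁻¹) volume Sys.a Sys.b :=
    ContinuousOn.intervalIntegrable_of_Icc Sys.hab.le
      ((cf.continuousOn_layer i l).mul (cf.continuousOn_inv_speed i))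
  have hbdry := cf.σ_smul_sub (cf.layer i l) i
  have hderiv : ∫ ξ in Sys.a..Sys.b, -(cf.σ i * (cf.speed i ξ)⁻¹ *
      (l * cf.layer i l ξ + cf.layerDefect i l)) =
      -cf.σ i * (l * (∫ ξ in Sys.a..Sys.b, cf.layer i l ξ * (cf.speed i ξ)⁻¹) +
        cf.layerDefect i l * cf.crossingTime i) := by
    rw [crossingTime, ← intervalIntegral.integral_const_mul, ← intervalIntegral.integral_const_mul,
      ← intervalIntegral.integral_add (hint.const_mul l)
        ((cf.intervalIntegrable_inv_speed i).const_mul _), ← intervalIntegral.integral_const_mul]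
    exact intervalIntegral.integral_congr fun ξ _ ↦ by ring
  rw [← (cf.hasACDeriv_layer i hl).integral_eq_sub Sys.hab.le, hderiv, layer_outflowEnd _ _ hl,
    layer_inflowEnd, smul_eq_mul] at hbdry
  linear_combination (-(l * ∫ ξ in Sys.a..Sys.b, cf.layer i l ξ * (cf.speed i ξ)⁻¹) -
    cf.layerDefect i l * cf.crossingTime i) * cf.σ_mul_self i - hbdry

theorem memLp_single_inv_speed (p : ENNReal) (i : Fin n) :
    MemLp (fun ξ ↦ EuclideanSpace.single i ((cf.speed i ξ)⁻¹ : 𝕜)) p Sys.measure := by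
  refine MemLp.mono_exponent (q := ⊤) (memLp_top_of_continuousOn_Icc ?_) le_top
  simp only [← RCLike.ofReal_inv]
  exact (PiLp.continuous_toLp 2 _).comp_continuousOn ((continuous_single i).comp_continuousOn
    (RCLike.continuous_ofReal.comp_continuousOn (cf.continuousOn_inv_speed i)))

/-- The state whose only nonzero characteristic variable is the `i`-th one, equal to
`1 / speed i`. It normalises the functionals `HBCS.CharForm.outflowFunctional`. -/
def testState (p : ENNReal) [Fact (1 ≤ p)] (i : Fin n) : Sys.StateSpace p :=
  cf.ofChar p (cf.memLp_single_inv_speed p i).toLp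

theorem outflowFunctional_testState (p : ENNReal) [Fact (1 ≤ p)] (i j : Fin n) {l : ℝ}
    (hl : 0 < l) : l * cf.outflowFunctional p i l (cf.testState p j) =
      if i = j then ((1 - cf.layerDefect i l * cf.crossingTime i : ℝ) : 𝕜) else 0 := by
  have happly : cf.outflowFunctional p i l (cf.testState p j) =
      ∫ ξ, (if i = j then ((cf.layer i l ξ * (cf.speed i ξ)⁻¹ : ℝ) : 𝕜) else 0) ∂Sys.measure := by
    rw [outflowFunctional, testState, ContinuousLinearMap.comp_apply, toChar_ofChar,
      coordPairing_apply]
    refine integral_congr_ae ?_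
    filter_upwards [(cf.memLp_single_inv_speed p j).coeFn_toLp] with ξ hξ
    rw [hξ, PiLp.single_apply]
    split_ifs with hij
    · rw [hij, RCLike.ofReal_mul, RCLike.ofReal_inv]
    · rw [mul_zero]
  rw [happly]
  split_ifs
  · rw [integral_ofReal, ← RCLike.ofReal_mul, integral_measure, integral_layer_div_speed _ _ hl]
  · rw [integral_zero, mul_zero]

theorem tendsto_mul_norm_sum_outflowFunctional
    (hR : ∀ i j, MemLp (fun ξ ↦ cf.lowerOrderCoeff ξ i j) ⊤ Sys.measure)
    (hgen : GeneratesC0Semigroup 𝕜 (Sys.OperatorA 2)) {β : Fin n → 𝕜}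
    (hβ : ∀ v : ℝ → KVec 𝕜 n, bdryAct Sys.WB (v Sys.b) (v Sys.a) = 0 →
      ∑ i, β i * cf.flux v (cf.outflowEnd i) i = 0) :
    Tendsto (fun l ↦ l * ‖∑ i, (β i * cf.σ i) • cf.outflowFunctional 2 i l‖) atTop (𝓝 0) := by
  let Φ (l : ℝ) : Sys.StateSpace 2 →L[𝕜] 𝕜 :=
    ∑ i, (β i * cf.σ i) • cf.outflowFunctional 2 i l
  let E (l : ℝ) : Sys.StateSpace 2 →L[𝕜] 𝕜 :=
    -∑ i, (β i * cf.σ i) • (cf.layerDefect i l : 𝕜) • cf.meanFunctional 2 i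
  let B := (cf.ofChar 2).comp (matMulLp 2 cf.lowerOrderCoeff hR)
  have hgreen {l : ℝ} (hl : 0 < l) (x z : Sys.StateSpace 2) (hxz : Sys.OperatorA 2 x z) :
      Φ l z = l * Φ l x - E l x + Φ l (B x) := by
    obtain ⟨v, hv, hv0⟩ := hxz
    simp only [Φ, E, sum_apply, smul_apply, neg_apply, smul_eq_mul, sub_neg_eq_add,
      cf.outflowFunctional_apply_of_maxOperator hR _ hl hv, Finset.mul_sum,
      ← Finset.sum_add_distrib]
    rw [← add_zero (Finset.sum _ _), ← hβ v hv0, ← Finset.sum_add_distrib]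
    refine Finset.sum_congr rfl fun i _ ↦ ?_
    simp only [B, ContinuousLinearMap.comp_apply]
    linear_combination (-β i * cf.flux v (cf.outflowEnd i) i) * cf.ofReal_σ_mul_self i
  have hE : Tendsto E atTop (𝓝 0) := by
    have hdefect (i : Fin n) : Tendsto (fun l ↦ (cf.layerDefect i l : 𝕜)) atTop (𝓝 0) := by
      simpa only [RCLike.ofReal_zero, Function.comp_def] using
        (RCLike.continuous_ofReal.tendsto 0).comp (cf.tendsto_layerDefect i)
    have hterm (i : Fin n) : Tendsto (fun l ↦
        (β i * cf.σ i) • (cf.layerDefect i l : 𝕜) • cf.meanFunctional 2 i) atTop (𝓝 0) := by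
      convert ((hdefect i).smul_const (cf.meanFunctional 2 i)).const_smul (β i * cf.σ i) using 2
      ext x
      simp only [smul_apply, zero_smul, smul_zero, zero_apply]
    simpa only [Finset.sum_const_zero, neg_zero] using
      (tendsto_finsetSum Finset.univ fun i _ ↦ hterm i).neg
  obtain ⟨C, hC⟩ := hgen.exists_functional_bound B
  refine squeeze_zero' ?_ ?_ (by simpa only [norm_zero, mul_zero] using hE.norm.const_mul C)
  · filter_upwards [eventually_ge_atTop 0] with l hl using by positivity
  · filter_upwards [hC, eventually_gt_atTop 0] with l hl hl0 using hl _ _ (hgreen hl0)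

theorem tendsto_mul_outflowFunctional_testState (p : ENNReal) [Fact (1 ≤ p)] (i j : Fin n) :
    Tendsto (fun l : ℝ ↦ (l : 𝕜) * cf.outflowFunctional p i l (cf.testState p j)) atTop
      (𝓝 (if i = j then 1 else 0)) := by
  have hlim : Tendsto (fun l ↦ 1 - cf.layerDefect i l * cf.crossingTime i) atTop (𝓝 1) := by
    simpa only [zero_mul, sub_zero] using
      ((cf.tendsto_layerDefect i).mul_const (cf.crossingTime i)).const_sub 1
  have hlim' : Tendsto (fun l ↦
      if i = j then ((1 - cf.layerDefect i l * cf.crossingTime i : ℝ) : 𝕜) else 0) atTop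
      (𝓝 (if i = j then 1 else 0)) := by
    split_ifs
    · simpa only [RCLike.ofReal_one, Function.comp_def] using
        (RCLike.continuous_ofReal.tendsto 1).comp hlim
    · exact tendsto_const_nhds
  refine hlim'.congr' ?_
  filter_upwards [eventually_gt_atTop 0] with l hl
  rw [outflowFunctional_testState _ _ _ _ hl]

theorem eq_zero_of_sum_mul_flux_outflowEnd_eq_zero
    (hR : ∀ i j, MemLp (fun ξ ↦ cf.lowerOrderCoeff ξ i j) ⊤ Sys.measure)
    (hgen : GeneratesC0Semigroup 𝕜 (Sys.OperatorA 2)) {β : Fin n → 𝕜}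
    (hβ : ∀ v : ℝ → KVec 𝕜 n, bdryAct Sys.WB (v Sys.b) (v Sys.a) = 0 →
      ∑ i, β i * cf.flux v (cf.outflowEnd i) i = 0) : β = 0 := by
  ext j
  have hsmall : Tendsto (fun l : ℝ ↦ (l : 𝕜) *
      (∑ i, (β i * cf.σ i) • cf.outflowFunctional 2 i l) (cf.testState 2 j)) atTop (𝓝 0) := by
    refine squeeze_zero_norm' ?_ (by simpa only [zero_mul] using
      (cf.tendsto_mul_norm_sum_outflowFunctional hR hgen hβ).mul_const ‖cf.testState 2 j‖)
    filter_upwards [eventually_ge_atTop 0] with l hl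
    rw [norm_mul, RCLike.norm_of_nonneg hl, mul_assoc]
    exact mul_le_mul_of_nonneg_left (ContinuousLinearMap.le_opNorm _ _) hl
  have hlim : Tendsto (fun l : ℝ ↦ (l : 𝕜) *
      (∑ i, (β i * cf.σ i) • cf.outflowFunctional 2 i l) (cf.testState 2 j)) atTop
      (𝓝 (β j * cf.σ j)) := by
    simpa only [sum_apply, smul_apply, smul_eq_mul, Finset.mul_sum, mul_left_comm, mul_ite,
      mul_one, mul_zero, Finset.sum_ite_eq', Finset.mem_univ, if_true] using
      tendsto_finsetSum Finset.univ fun i _ ↦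
        (cf.tendsto_mul_outflowFunctional_testState 2 i j).const_mul (β i * cf.σ i)
  rw [Pi.zero_apply, ← mul_one (β j), ← cf.ofReal_σ_mul_self j, ← mul_assoc,
    tendsto_nhds_unique hlim hsmall, zero_mul]

theorem injective_of_generates
    (hR : ∀ i j, MemLp (fun ξ ↦ cf.lowerOrderCoeff ξ i j) ⊤ Sys.measure)
    (hWB : Sys.WB.rank = n) (hgen : GeneratesC0Semigroup 𝕜 (Sys.OperatorA 2)) :
    Function.Injective ((bdryMap Sys.WB).prod cf.outgoing) := by
  by_contra hinj
  obtain ⟨β, hβ0, hβ⟩ := exists_dual_vanishing_on_ker (bdryMap_surjective hWB)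
    (by simp only [Module.finrank_prod, finrank_euclideanSpace, Module.finrank_fin_fun,
      Fintype.card_fin]) hinj
  refine hβ0 (LinearMap.ext fun w ↦ ?_)
  have hcoeff := cf.eq_zero_of_sum_mul_flux_outflowEnd_eq_zero hR hgen
    (β := fun i ↦ β fun j ↦ if i = j then 1 else 0) fun v hv ↦ by
      refine Eq.trans ?_ (hβ (v Sys.b, v Sys.a) hv)
      rw [β.pi_apply_eq_sum_univ]
      simp only [outgoing_apply, smul_eq_mul, mul_comm]
  rw [β.pi_apply_eq_sum_univ]
  exact Finset.sum_eq_zero fun i _ ↦ (congrArg (w i • ·) (congrFun hcoeff i)).trans (smul_zero _)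

end CharForm

end HBCS

section CoordNorm

variable {𝕜 : Type*} [RCLike 𝕜] {n : ℕ} {α : Type*} [MeasurableSpace α] {μ : Measure α}

/-- The `L¹` norm on `L¹(μ, 𝕂ⁿ)` taken with respect to the `ℓ¹` norm on `𝕂ⁿ` instead of the
Euclidean one, which decouples the components. -/
def coordNorm (X : Lp (KVec 𝕜 n) 1 μ) : ℝ := ∑ i, ∫ ξ, ‖X ξ i‖ ∂μ

theorem integrable_coord (X : Lp (KVec 𝕜 n) 1 μ) (i : Fin n) : Integrable (fun ξ ↦ X ξ i) μ :=
  memLp_one_iff_integrable.1 (memLp_coord X i)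

theorem norm_le_coordNorm (X : Lp (KVec 𝕜 n) 1 μ) : ‖X‖ ≤ coordNorm X := by
  rw [L1.norm_eq_integral_norm, coordNorm,
    ← integral_finsetSum _ fun i _ ↦ (integrable_coord X i).norm]
  refine integral_mono (L1.integrable_coeFn X).norm
    (integrable_finsetSum _ fun i _ ↦ (integrable_coord X i).norm) fun ξ ↦ ?_
  have hsum : X ξ = ∑ i, EuclideanSpace.single i (X ξ i) := by
    ext j
    simp
  calc ‖X ξ‖ ≤ ∑ i, ‖EuclideanSpace.single i (X ξ i)‖ := by
        conv_lhs => rw [hsum]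
        exact norm_sum_le _ _
    _ = ∑ i, ‖X ξ i‖ := by simp only [PiLp.norm_single]

theorem coordNorm_le (X : Lp (KVec 𝕜 n) 1 μ) : coordNorm X ≤ n * ‖X‖ := by
  rw [coordNorm, L1.norm_eq_integral_norm]
  calc ∑ i, ∫ ξ, ‖X ξ i‖ ∂μ ≤ ∑ _i : Fin n, ∫ ξ, ‖X ξ‖ ∂μ :=
        Finset.sum_le_sum fun i _ ↦ integral_mono (integrable_coord X i).norm
          (L1.integrable_coeFn X).norm fun ξ ↦ PiLp.norm_apply_le _ i
    _ = n * ∫ ξ, ‖X ξ‖ ∂μ := by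
        rw [Finset.sum_const, Finset.card_univ, Fintype.card_fin, nsmul_eq_mul]

theorem memLp_conjPhase_coord (X : Lp (KVec 𝕜 n) 1 μ) (i : Fin n) :
    MemLp (fun ξ ↦ conjPhase (X ξ i)) ⊤ μ :=
  memLp_top_of_bound (measurable_conjPhase.comp_aemeasurable
    (memLp_coord X i).aestronglyMeasurable.aemeasurable).aestronglyMeasurable 1
    (.of_forall fun _ ↦ norm_conjPhase_le _)

variable [IsFiniteMeasure μ]

/-- The functional `Y ↦ ∑ i, ∫ conjPhase Xᵢ * Yᵢ`, whose real part is a subgradient of `coordNorm`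
at `X`. -/
def coordNormSubgradient (X : Lp (KVec 𝕜 n) 1 μ) : Lp (KVec 𝕜 n) 1 μ →L[𝕜] 𝕜 :=
  ∑ i, coordPairing 1 _ (memLp_conjPhase_coord X i) i

theorem re_coordNormSubgradient_apply (X Y : Lp (KVec 𝕜 n) 1 μ) :
    RCLike.re (coordNormSubgradient X Y) =
      ∑ i, ∫ ξ, RCLike.re (conjPhase (X ξ i) * Y ξ i) ∂μ := by
  simp only [coordNormSubgradient, sum_apply, coordPairing_apply, map_sum]
  exact Finset.sum_congr rfl fun i _ ↦
    (integral_re (integrable_mul_coord (memLp_conjPhase_coord X i) Y i)).symm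

theorem re_coordNormSubgradient_apply_self (X : Lp (KVec 𝕜 n) 1 μ) :
    RCLike.re (coordNormSubgradient X X) = coordNorm X := by
  simp only [re_coordNormSubgradient_apply, conjPhase_mul_self, RCLike.ofReal_re, coordNorm]

theorem re_coordNormSubgradient_apply_le (X Y : Lp (KVec 𝕜 n) 1 μ) :
    RCLike.re (coordNormSubgradient X Y) ≤ coordNorm Y := by
  rw [re_coordNormSubgradient_apply, coordNorm]
  exact Finset.sum_le_sum fun i _ ↦ integral_mono
    (integrable_mul_coord (memLp_conjPhase_coord X i) Y i).re (integrable_coord Y i).norm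
    fun ξ ↦ re_conjPhase_mul_le _ _

theorem coordNorm_sub_le (X Y : Lp (KVec 𝕜 n) 1 μ) :
    coordNorm X - coordNorm Y ≤ n * ‖X - Y‖ := by
  have hXY := re_coordNormSubgradient_apply_le X Y
  have hsub := re_coordNormSubgradient_apply_le X (X - Y)
  rw [map_sub, map_sub, re_coordNormSubgradient_apply_self] at hsub
  linarith [coordNorm_le (X - Y)]

theorem HasACDeriv.coordNorm {a b : ℝ} (hab : a ≤ b) {X X' : ℝ → Lp (KVec 𝕜 n) 1 μ}
    (h : HasACDeriv a b X X') : HasACDeriv a b (fun t ↦ coordNorm (X t))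
      (fun t ↦ RCLike.re (coordNormSubgradient (X t) (X' t))) := by
  refine .of_deriv_eq hab (absolutelyContinuousOnInterval_of_dist_le n h.ac fun s _ t _ ↦ ?_) ?_
  · rw [Real.dist_eq, dist_eq_norm, abs_le']
    refine ⟨coordNorm_sub_le _ _, ?_⟩
    rw [neg_sub, norm_sub_rev]
    exact coordNorm_sub_le _ _
  filter_upwards [h.hasDerivAt] with t ht htI hdiff
  have hsub : HasDerivAt (fun s ↦ RCLike.re (coordNormSubgradient (X t) (X s)))
      (RCLike.re (coordNormSubgradient (X t) (X' t))) t :=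
    ((RCLike.reCLM (K := 𝕜)).comp
      ((coordNormSubgradient (X t)).restrictScalars ℝ)).hasFDerivAt.comp_hasDerivAt t (ht htI)
  exact eq_of_hasDerivAt_of_touching hdiff.hasDerivAt hsub
    (.of_forall fun s ↦ re_coordNormSubgradient_apply_le _ _)
    (re_coordNormSubgradient_apply_self _)

end CoordNorm

namespace HBCS.CharForm

variable {𝕜 : Type*} [RCLike 𝕜] {n : ℕ} {Sys : HBCS 𝕜 n} (cf : Sys.CharForm)

theorem re_coordNormSubgradient_toChar_sub
    (hR : ∀ i j, MemLp (fun ξ ↦ cf.lowerOrderCoeff ξ i j) ⊤ Sys.measure)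
    {x z : Sys.StateSpace 1} {v : ℝ → KVec 𝕜 n} (h : Sys.MaxOperator 1 x z v) :
    RCLike.re (coordNormSubgradient (cf.toChar 1 x)
        (cf.toChar 1 z - matMulLp 1 cf.lowerOrderCoeff hR x)) =
      ∑ i, ‖cf.flux v (cf.inflowEnd i) i‖ - ∑ i, ‖cf.flux v (cf.outflowEnd i) i‖ := by
  rw [re_coordNormSubgradient_apply, ← Finset.sum_sub_distrib]
  refine Finset.sum_congr rfl fun i _ ↦ ?_
  obtain ⟨w', hw, hz⟩ := cf.exists_hasACDeriv_flux hR h i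
  have hint : ∫ ξ, RCLike.re (conjPhase (cf.toChar 1 x ξ i) *
      (cf.toChar 1 z - matMulLp 1 cf.lowerOrderCoeff hR x : Sys.StateSpace 1) ξ i) ∂Sys.measure =
      ∫ ξ, cf.σ i * RCLike.re (conjPhase (cf.flux v ξ i) * w' ξ) ∂Sys.measure := by
    refine integral_congr_ae ?_
    filter_upwards [cf.toChar_ae_eq h, hz, ae_restrict_mem measurableSet_Icc,
      Lp.coeFn_sub (cf.toChar 1 z) (matMulLp 1 cf.lowerOrderCoeff hR x)] with ξ hx hzξ hξ hsub
    have hsign : cf.σ i * (cf.speed i ξ)⁻¹ / |cf.σ i * (cf.speed i ξ)⁻¹| = cf.σ i := by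
      have hpos := inv_pos.2 (cf.speed_pos i ξ hξ)
      have hσ : |cf.σ i| = 1 := by rcases cf.σ_eq i with h | h <;> simp [h]
      rw [abs_mul, hσ, one_mul, abs_of_pos hpos, mul_div_cancel_right₀ _ hpos.ne']
    rw [hsub, Pi.sub_apply, PiLp.sub_apply, hzξ, add_sub_cancel_right, hx i, conjPhase_ofReal_mul,
      hsign, mul_assoc, RCLike.re_ofReal_mul]
  rw [hint, integral_const_mul, integral_measure, (hw.norm Sys.hab.le).integral_eq_sub Sys.hab.le,
    ← smul_eq_mul, cf.σ_smul_sub fun ξ ↦ ‖cf.flux v ξ i‖]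

theorem exists_re_coordNormSubgradient_toChar_le
    (hR : ∀ i j, MemLp (fun ξ ↦ cf.lowerOrderCoeff ξ i j) ⊤ Sys.measure) :
    ∃ C : ℝ, 0 ≤ C ∧ ∀ (x z : Sys.StateSpace 1) (v : ℝ → KVec 𝕜 n), Sys.MaxOperator 1 x z v →
      RCLike.re (coordNormSubgradient (cf.toChar 1 x) (cf.toChar 1 z)) ≤
        ∑ i, ‖cf.flux v (cf.inflowEnd i) i‖ - ∑ i, ‖cf.flux v (cf.outflowEnd i) i‖ +
          C * coordNorm (cf.toChar 1 x) := by
  set R := (matMulLp 1 cf.lowerOrderCoeff hR).comp (cf.ofChar 1)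
  refine ⟨n * ‖R‖, by positivity, fun x z v h ↦ ?_⟩
  have hlower : coordNorm (matMulLp 1 cf.lowerOrderCoeff hR x) ≤
      n * ‖R‖ * coordNorm (cf.toChar 1 x) := by
    refine (coordNorm_le _).trans ?_
    rw [mul_assoc]
    refine mul_le_mul_of_nonneg_left ?_ n.cast_nonneg
    conv_lhs => rw [← cf.ofChar_toChar x]
    exact R.le_opNorm_of_le (norm_le_coordNorm _)
  have htransport := cf.re_coordNormSubgradient_toChar_sub hR h
  rw [map_sub, map_sub] at htransport
  linarith [re_coordNormSubgradient_apply_le (cf.toChar 1 x) (matMulLp 1 cf.lowerOrderCoeff hR x)]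

/-- A positive weight for the `i`-th characteristic variable, equal to `1` where it enters and to
`exp (κ * (b - a))` where it leaves. -/
def weight (κ : ℝ) (i : Fin n) (ξ : ℝ) : ℝ :=
  Real.exp (κ * (cf.σ i * (cf.inflowEnd i - ξ)))

theorem weight_inflowEnd (κ : ℝ) (i : Fin n) : cf.weight κ i (cf.inflowEnd i) = 1 := by
  rw [weight, sub_self, mul_zero, mul_zero, Real.exp_zero]

theorem weight_outflowEnd (κ : ℝ) (i : Fin n) :
    cf.weight κ i (cf.outflowEnd i) = Real.exp (κ * (Sys.b - Sys.a)) := by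
  have hends := cf.σ_smul_sub id i
  simp only [id_eq, smul_eq_mul] at hends
  rw [weight, ← hends, ← mul_assoc (cf.σ i), σ_mul_self, one_mul]

theorem contDiff_weight (κ : ℝ) (i : Fin n) :
    ContDiff ℝ 1 fun ξ ↦ (cf.weight κ i ξ : 𝕜) := by
  refine (RCLike.ofRealCLM (K := 𝕜)).contDiff.comp (Real.contDiff_exp.comp ?_)
  fun_prop

/-- The diagonalisation whose characteristic variables are those of `cf` multiplied by
`HBCS.CharForm.weight κ`. -/
def rescale (κ : ℝ) : Sys.CharForm where
  S ξ := Matrix.diagonal (fun i ↦ (cf.weight κ i ξ : 𝕜)) * cf.S ξ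
  σ := cf.σ
  speed := cf.speed
  contDiffOn_S i j := by
    simp only [Matrix.diagonal_mul]
    exact (cf.contDiff_weight κ i).contDiffOn.mul (cf.contDiffOn_S i j)
  isUnit_S ξ hξ := by
    refine IsUnit.mul ?_ (cf.isUnit_S ξ hξ)
    refine Matrix.isUnit_diagonal.2 (Pi.isUnit_iff.2 fun i ↦ ?_)
    exact (RCLike.ofReal_ne_zero.2 (Real.exp_ne_zero _)).isUnit
  σ_eq := cf.σ_eq
  continuousOn_speed := cf.continuousOn_speed
  speed_pos := cf.speed_pos
  diagonalises := by
    filter_upwards [cf.diagonalises] with ξ hξ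
    rw [Matrix.mul_assoc _ (cf.S ξ), Matrix.mul_assoc _ (cf.S ξ * Sys.P₁), hξ, ← Matrix.mul_assoc,
      ← Matrix.mul_assoc, (Matrix.commute_diagonal _ _).eq]

theorem norm_flux_rescale (κ : ℝ) (v : ℝ → KVec 𝕜 n) (ξ : ℝ) (i : Fin n) :
    ‖(cf.rescale κ).flux v ξ i‖ = cf.weight κ i ξ * ‖cf.flux v ξ i‖ := by
  have hflux : (cf.rescale κ).flux v ξ i = cf.weight κ i ξ * cf.flux v ξ i := by
    simp only [flux, rescale, Matrix.mul_assoc, matAct_mul _ (cf.S ξ * Sys.P₁)]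
    simp only [matAct, Matrix.mulVec_diagonal]
  rw [hflux, norm_mul, RCLike.norm_of_nonneg (show 0 ≤ cf.weight κ i ξ from Real.exp_nonneg _)]

theorem norm_flux_rescale_inflowEnd (κ : ℝ) (v : ℝ → KVec 𝕜 n) (i : Fin n) :
    ‖(cf.rescale κ).flux v ((cf.rescale κ).inflowEnd i) i‖ = ‖cf.flux v (cf.inflowEnd i) i‖ := by
  rw [norm_flux_rescale, show (cf.rescale κ).inflowEnd i = cf.inflowEnd i from rfl,
    weight_inflowEnd, one_mul]

theorem norm_flux_rescale_outflowEnd (κ : ℝ) (v : ℝ → KVec 𝕜 n) (i : Fin n) :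
    ‖(cf.rescale κ).flux v ((cf.rescale κ).outflowEnd i) i‖ =
      Real.exp (κ * (Sys.b - Sys.a)) * ‖cf.flux v (cf.outflowEnd i) i‖ := by
  rw [norm_flux_rescale, show (cf.rescale κ).outflowEnd i = cf.outflowEnd i from rfl,
    weight_outflowEnd]

theorem exists_dissipative_charForm
    (hP₀ : ∀ i j, MemLp (fun ξ ↦ Sys.P₀ ξ i j) ⊤ Sys.measure)
    (hH : ∀ i j, MemLp (fun ξ ↦ Sys.H ξ i j) ⊤ Sys.measure)
    (hinj : Function.Injective ((bdryMap Sys.WB).prod cf.outgoing)) :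
    ∃ (cf' : Sys.CharForm) (C c : ℝ), 0 ≤ C ∧ 0 ≤ c ∧
      ∀ (x z : Sys.StateSpace 1) (v : ℝ → KVec 𝕜 n), Sys.MaxOperator 1 x z v →
        RCLike.re (coordNormSubgradient (cf'.toChar 1 x) (cf'.toChar 1 z)) ≤
          c * ‖bdryAct Sys.WB (v Sys.b) (v Sys.a)‖ - ∑ i, ‖cf.flux v (cf.outflowEnd i) i‖ +
            C * coordNorm (cf'.toChar 1 x) := by
  obtain ⟨cin, hcin, hin⟩ := cf.exists_sum_norm_flux_inflowEnd_le
  obtain ⟨ctr, hctr, htr⟩ := cf.exists_norm_trace_le hinj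
  have hc : 0 ≤ cin * ctr := mul_nonneg hcin hctr
  set κ : ℝ := Real.log (cin * ctr + 1) / (Sys.b - Sys.a) with hκ
  have hexp : Real.exp (κ * (Sys.b - Sys.a)) = cin * ctr + 1 := by
    rw [hκ, div_mul_cancel₀ _ (sub_pos.2 Sys.hab).ne', Real.exp_log (by linarith)]
  obtain ⟨C, hC, hdiss⟩ := (cf.rescale κ).exists_re_coordNormSubgradient_toChar_le
    ((cf.rescale κ).memLp_lowerOrderCoeff hP₀ hH)
  refine ⟨cf.rescale κ, C, cin * ctr, hC, hc, fun x z v h ↦ ?_⟩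
  have hxz := hdiss x z v h
  simp only [norm_flux_rescale_inflowEnd, norm_flux_rescale_outflowEnd, hexp,
    ← Finset.mul_sum] at hxz
  have hinflow := (hin v).trans (mul_le_mul_of_nonneg_left (htr v) hcin)
  linarith

theorem continuousOn_flux_outflowEnd {p : ENNReal} [Fact (1 ≤ p)]
    (hR : ∀ i j, MemLp (fun ξ ↦ cf.lowerOrderCoeff ξ i j) ⊤ Sys.measure) {I : Set ℝ}
    {x z : ℝ → Sys.StateSpace p} (hx : ContinuousOn x I) (hz : ContinuousOn z I)
    {v : ℝ → ℝ → KVec 𝕜 n} (hv : ∀ t ∈ I, Sys.MaxOperator p (x t) (z t) (v t)) (i : Fin n) :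
    ContinuousOn (fun t ↦ cf.flux (v t) (cf.outflowEnd i) i) I := by
  set Φ := cf.outflowFunctional p i 1
  set F : Sys.StateSpace p →L[𝕜] 𝕜 := Φ + ((cf.layerDefect i 1 : ℝ) : 𝕜) • cf.meanFunctional p i +
    Φ.comp ((cf.ofChar p).comp (matMulLp p cf.lowerOrderCoeff hR))
  have hflux : ∀ t ∈ I,
      cf.flux (v t) (cf.outflowEnd i) i = cf.σ i * (F (x t) - Φ (z t)) := fun t ht ↦ by
    have hgreen := cf.outflowFunctional_apply_of_maxOperator hR i one_pos (hv t ht)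
    simp only [F, add_apply, smul_apply, smul_eq_mul, ContinuousLinearMap.comp_apply]
    rw [RCLike.ofReal_one, one_mul] at hgreen
    linear_combination -cf.flux (v t) (cf.outflowEnd i) i * cf.ofReal_σ_mul_self i +
      (cf.σ i : 𝕜) * hgreen
  exact ((continuousOn_const.mul ((F.continuous.comp_continuousOn hx).sub
    (Φ.continuous.comp_continuousOn hz)))).congr hflux

end HBCS.CharForm

theorem intervalIntegrable_of_continuousOn_Ici {E : Type*} [NormedAddCommGroup E] {a b : ℝ}
    {f : ℝ → E} (hab : a ≤ b) (hf : ContinuousOn f (Ici a)) : IntervalIntegrable f volume a b :=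
  (hf.mono ((uIcc_of_le hab).trans_subset Icc_subset_Ici_self)).intervalIntegrable

namespace HBCS

theorem IsClassicalSolution.continuousOn_derivWithin {𝕜 : Type*} [RCLike 𝕜] {n : ℕ}
    {Sys : HBCS 𝕜 n} {p : ENNReal} [Fact (1 ≤ p)] {u y : ℝ → KVec 𝕜 n}
    {x : ℝ → Sys.StateSpace p} (h : Sys.IsClassicalSolution p u x y) :
    ContinuousOn (derivWithin x (Ici 0)) (Ici 0) :=
  h.x_contDiff.continuousOn_derivWithin (uniqueDiffOn_Ici 0) le_rfl

theorem IsClassicalSolution.hasACDeriv {𝕜 : Type*} [RCLike 𝕜] {n : ℕ}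
    {Sys : HBCS 𝕜 n} {p : ENNReal} [Fact (1 ≤ p)] {u y : ℝ → KVec 𝕜 n}
    {x : ℝ → Sys.StateSpace p} (h : Sys.IsClassicalSolution p u x y) {T : ℝ} (hT : 0 ≤ T) :
    HasACDeriv 0 T x (derivWithin x (Ici 0)) :=
  have hsub : Icc 0 T ⊆ Ici 0 := Icc_subset_Ici_self
  .of_hasDerivWithinAt hT (fun t ht ↦ ((h.x_contDiff.differentiableOn one_ne_zero t
    (hsub ht)).hasDerivWithinAt).mono hsub) (h.continuousOn_derivWithin.mono hsub)

namespace CharForm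

variable {𝕜 : Type*} [RCLike 𝕜] {n : ℕ} {Sys : HBCS 𝕜 n} (cf : Sys.CharForm)

theorem norm_le_coordNorm_toChar (x : Sys.StateSpace 1) :
    ‖x‖ ≤ ‖cf.ofChar 1‖ * coordNorm (cf.toChar 1 x) := by
  conv_lhs => rw [← cf.ofChar_toChar x]
  exact (cf.ofChar 1).le_opNorm_of_le (norm_le_coordNorm _)

theorem coordNorm_toChar_le (x : Sys.StateSpace 1) :
    coordNorm (cf.toChar 1 x) ≤ n * ‖cf.toChar 1‖ * ‖x‖ := by
  rw [mul_assoc]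
  exact (coordNorm_le _).trans
    (mul_le_mul_of_nonneg_left ((cf.toChar 1).le_opNorm x) n.cast_nonneg)

theorem coordNorm_toChar_add_integral_le {T C : ℝ} (hT : 0 ≤ T) (hC : 0 ≤ C)
    {x x' : ℝ → Sys.StateSpace 1} {q o : ℝ → ℝ} (hx : HasACDeriv 0 T x x')
    (hq : IntervalIntegrable q volume 0 T) (ho : IntervalIntegrable o volume 0 T)
    (hq_nonneg : ∀ t ∈ Ioo 0 T, 0 ≤ q t) (ho_nonneg : ∀ t ∈ Ioo 0 T, 0 ≤ o t)
    (hdiss : ∀ t ∈ Ioo 0 T,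
      RCLike.re (coordNormSubgradient (cf.toChar 1 (x t)) (cf.toChar 1 (x' t))) ≤
        q t - o t + C * coordNorm (cf.toChar 1 (x t))) :
    coordNorm (cf.toChar 1 (x T)) + ∫ t in 0..T, o t ≤
      Real.exp (C * T) * (coordNorm (cf.toChar 1 (x 0)) + ∫ t in 0..T, q t) :=
  gronwall_of_hasACDeriv hT hC
    ((hx.clm_comp ((cf.toChar 1).restrictScalars ℝ)).coordNorm hT) hq ho hq_nonneg ho_nonneg
    (.of_forall hdiss)

theorem exists_norm_add_integral_outflow_le
    (hP₀ : ∀ i j, MemLp (fun ξ ↦ Sys.P₀ ξ i j) ⊤ Sys.measure)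
    (hH : ∀ i j, MemLp (fun ξ ↦ Sys.H ξ i j) ⊤ Sys.measure)
    (hinj : Function.Injective ((bdryMap Sys.WB).prod cf.outgoing)) {T : ℝ} (hT : 0 ≤ T) :
    ∃ c : ℝ, 0 ≤ c ∧ ∀ (u : ℝ → KVec 𝕜 n) (x x' : ℝ → Sys.StateSpace 1) (v : ℝ → ℝ → KVec 𝕜 n),
      (∀ t ∈ Ioo 0 T, Sys.MaxOperator 1 (x t) (x' t) (v t)) →
      (∀ t ∈ Ioo 0 T, u t = bdryAct Sys.WB (v t Sys.b) (v t Sys.a)) →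
      HasACDeriv 0 T x x' → IntervalIntegrable u volume 0 T →
      IntervalIntegrable (fun t ↦ ∑ i, ‖cf.flux (v t) (cf.outflowEnd i) i‖) volume 0 T →
        ‖x T‖ + ∫ t in 0..T, ∑ i, ‖cf.flux (v t) (cf.outflowEnd i) i‖ ≤
          c * ((∫ t in 0..T, ‖u t‖) + ‖x 0‖) := by
  obtain ⟨cf', C, d, hC, hd, hdiss⟩ := cf.exists_dissipative_charForm hP₀ hH hinj
  set r := ‖cf'.ofChar 1‖ + 1
  set s := n * ‖cf'.toChar 1‖ + d
  refine ⟨r * (Real.exp (C * T) * s), by positivity, fun u x x' v hv hu hx huint ho ↦ ?_⟩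
  have henergy := cf'.coordNorm_toChar_add_integral_le hT hC hx (huint.norm.const_mul d) ho
    (fun t _ ↦ by positivity) (fun t _ ↦ by positivity)
    fun t ht ↦ by simpa only [hu t ht] using hdiss _ _ _ (hv t ht)
  rw [intervalIntegral.integral_const_mul] at henergy
  set V : ℝ → ℝ := fun t ↦ coordNorm (cf'.toChar 1 (x t))
  set U := ∫ t in 0..T, ‖u t‖
  set O := ∫ t in 0..T, ∑ i, ‖cf.flux (v t) (cf.outflowEnd i) i‖
  have hU : 0 ≤ U := intervalIntegral.integral_nonneg hT fun _ _ ↦ norm_nonneg _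
  have hO : 0 ≤ O := intervalIntegral.integral_nonneg hT fun _ _ ↦ by positivity
  have hVT : 0 ≤ V T := (norm_nonneg _).trans (norm_le_coordNorm _)
  have hinitial : V 0 + d * U ≤ s * (U + ‖x 0‖) := by
    have hxU : 0 ≤ n * ‖cf'.toChar 1‖ * U + d * ‖x 0‖ := by positivity
    linarith [cf'.coordNorm_toChar_le (x 0)]
  calc ‖x T‖ + O ≤ r * (V T + O) := by
        have hnonneg : 0 ≤ V T + ‖cf'.ofChar 1‖ * O := by positivity
        linarith [cf'.norm_le_coordNorm_toChar (x T)]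
    _ ≤ r * (Real.exp (C * T) * (s * (U + ‖x 0‖))) := by
        gcongr
        exact henergy.trans (by gcongr)
    _ = r * (Real.exp (C * T) * s) * (U + ‖x 0‖) := by ring

theorem exists_norm_bdryAct_le_add_outflow
    (hinj : Function.Injective ((bdryMap Sys.WB).prod cf.outgoing))
    (W : Matrix (Fin n) (Fin n ⊕ Fin n) 𝕜) :
    ∃ c : ℝ, 0 ≤ c ∧ ∀ v : ℝ → KVec 𝕜 n, ‖bdryAct W (v Sys.b) (v Sys.a)‖ ≤
      c * (‖bdryAct Sys.WB (v Sys.b) (v Sys.a)‖ + ∑ i, ‖cf.flux v (cf.outflowEnd i) i‖) := by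
  obtain ⟨cW, hcW, hW⟩ := exists_norm_bdryAct_le W
  obtain ⟨ctr, hctr, htr⟩ := cf.exists_norm_trace_le hinj
  refine ⟨cW * ctr, mul_nonneg hcW hctr, fun v ↦ (hW _ _).trans ?_⟩
  rw [mul_assoc]
  exact mul_le_mul_of_nonneg_left (htr v) hcW

theorem exists_integral_norm_output_add_norm_le
    (hP₀ : ∀ i j, MemLp (fun ξ ↦ Sys.P₀ ξ i j) ⊤ Sys.measure)
    (hH : ∀ i j, MemLp (fun ξ ↦ Sys.H ξ i j) ⊤ Sys.measure)
    (hinj : Function.Injective ((bdryMap Sys.WB).prod cf.outgoing)) {T : ℝ} (hT : 0 ≤ T) :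
    ∃ c : ℝ, 0 < c ∧ ∀ (u : ℝ → KVec 𝕜 n) (x : ℝ → Sys.StateSpace 1) (y : ℝ → KVec 𝕜 n),
      Sys.IsClassicalSolution 1 u x y →
        (∫ t in 0..T, ‖y t‖) + ‖x T‖ ≤ c * ((∫ t in 0..T, ‖u t‖) + ‖x 0‖) := by
  obtain ⟨c, hc, henergy⟩ := cf.exists_norm_add_integral_outflow_le hP₀ hH hinj hT
  obtain ⟨d, hd, houtput⟩ := cf.exists_norm_bdryAct_le_add_outflow hinj Sys.WC
  refine ⟨d + (d + 1) * c + 1, by positivity, fun u x y hsol ↦ ?_⟩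
  choose! v hv hu hy using hsol.eqn
  have hu_int : IntervalIntegrable u volume 0 T :=
    intervalIntegrable_of_continuousOn_Ici hT hsol.u_cont
  have ho_int : IntervalIntegrable (fun t ↦ ∑ i, ‖cf.flux (v t) (cf.outflowEnd i) i‖) volume 0 T :=
    intervalIntegrable_of_continuousOn_Ici hT <| continuousOn_finsetSum Finset.univ fun i _ ↦
      (cf.continuousOn_flux_outflowEnd (cf.memLp_lowerOrderCoeff hP₀ hH)
        hsol.x_contDiff.continuousOn hsol.continuousOn_derivWithin hv i).norm
  have hstate := henergy u x _ v (fun t ht ↦ hv t ht.1.le) (fun t ht ↦ hu t ht.1.le)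
    (hsol.hasACDeriv hT) hu_int ho_int
  have hy_le := intervalIntegral.integral_mono_on hT
    (intervalIntegrable_of_continuousOn_Ici hT hsol.y_cont).norm
    ((hu_int.norm.add ho_int).const_mul d) fun t ht ↦ by
      simpa only [hy t ht.1, hu t ht.1] using houtput (v t)
  rw [intervalIntegral.integral_const_mul, intervalIntegral.integral_add hu_int.norm ho_int]
    at hy_le
  set U := ∫ t in 0..T, ‖u t‖
  set O := ∫ t in 0..T, ∑ i, ‖cf.flux (v t) (cf.outflowEnd i) i‖
  have hU : 0 ≤ U := intervalIntegral.integral_nonneg hT fun _ _ ↦ norm_nonneg _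
  have hO : 0 ≤ O := intervalIntegral.integral_nonneg hT fun _ _ ↦ by positivity
  calc (∫ t in 0..T, ‖y t‖) + ‖x T‖ ≤ d * U + (d + 1) * (‖x T‖ + O) := by
        have hxO : 0 ≤ d * ‖x T‖ + O := by positivity
        linarith
    _ ≤ d * U + (d + 1) * (c * (U + ‖x 0‖)) := by gcongr
    _ ≤ (d + (d + 1) * c + 1) * (U + ‖x 0‖) := by
        have hrest : 0 ≤ d * ‖x 0‖ + (U + ‖x 0‖) := by positivity
        linarith

end CharForm

end HBCS

end

theorem mainTheorem8_general {𝕜 : Type*} [RCLike 𝕜] {n : ℕ} (Sys : HBCS 𝕜 n)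
    (hP₀ : ∀ i j, MemLp (fun ξ ↦ Sys.P₀ ξ i j) ⊤ Sys.measure)
    (hH : ∀ i j, MemLp (fun ξ ↦ Sys.H ξ i j) ⊤ Sys.measure)
    (hWB : Sys.WB.rank = n) (hgen : GeneratesC0Semigroup 𝕜 (Sys.OperatorA 2))
    (hDiag : Sys.DiagonalisationAssumption) :
    ∀ t : ℝ, 0 < t → ∃ c : ℝ, 0 < c ∧
      ∀ (u : ℝ → KVec 𝕜 n) (x : ℝ → Sys.StateSpace 1) (y : ℝ → KVec 𝕜 n),
        Sys.IsClassicalSolution 1 u x y →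
          (∫ s in (0 : ℝ)..t, ‖y s‖) + ‖x t‖ ≤ c * ((∫ s in (0 : ℝ)..t, ‖u s‖) + ‖x 0‖) := by
  obtain ⟨cf⟩ := hDiag.nonempty_charForm
  have hinj := cf.injective_of_generates (cf.memLp_lowerOrderCoeff hP₀ hH) hWB hgen
  exact fun t ht ↦ cf.exists_integral_norm_output_add_norm_le hP₀ hH hinj ht.le

theorem mainTheorem8 {𝕜 : Type*} [RCLike 𝕜] {n : ℕ} (Sys : HBCS 𝕜 n)
    (hSys : Sys.StandingAssumptions) (hDiag : Sys.DiagonalisationAssumption) :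
    ∀ t : ℝ, 0 < t → ∃ c : ℝ, 0 < c ∧
      ∀ (u : ℝ → KVec 𝕜 n) (x : ℝ → Sys.StateSpace 1) (y : ℝ → KVec 𝕜 n),
        Sys.IsClassicalSolution 1 u x y →
          (∫ s in (0 : ℝ)..t, ‖y s‖) + ‖x t‖ ≤ c * ((∫ s in (0 : ℝ)..t, ‖u s‖) + ‖x 0‖) := by
  exact mainTheorem8_general Sys hSys.P₀_bounded hSys.H_bounded hSys.WB_fullRank hSys.generates
    hDiag
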